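/- **Setting.** Let $\mathcal H$ be a real Hilbert space, $m\ge 2$, and let $\mathcal H^{m-1}$ carry the inner product $\langle \mathbf x,\mathbf y\rangle=\sum_{i=1}^{m-1}\langle x_i,y_i\rangle$. Write $\Delta(a)=(a,\dots,a)\in\mathcal H^{m-1}$ for $a\in\mathcal H$ and $\mathbf D=\Delta(\mathcal H)$, with normal cone operator $N_{\mathbf D}$. A set-valued operator $A:\mathcal H\rightrightarrows\mathcal H$ is $\sigma$-monotone ($\sigma\in\mathbb R$) if $\langle x-y,u-v\rangle\ge\sigma\|x-y\|^2$ for all $u\in A(x)$, $v\in A(y)$, and maximal $\sigma$-monotone if moreover no $\sigma$-monotone operator has a graph properly containing that of $A$. Let $\operatorname{zer}A=\{x:0\in A(x)\}$, $\operatorname{Fix}A=\{x:x\in A(x)\}$, $J_{\gamma A}=(\mathrm{Id}+\gamma A)^{-1}$ and $R_{\gamma A}=2J_{\gamma A}-\mathrm{Id}$ (set-valued). Let $A_i:\mathcal H\rightrightarrows\mathcal H$ be maximal $\sigma_i$-monotone for $i=1,\dots,m$, with $\operatorname{zer}(A_1+\dots+A_m)\neq\emptyset$. Let $\mu\in(0,2)$,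 $\lambda>0$ and $\lambda_1,\dots,\lambda_{m-1}>0$ with $\sum_{i=1}^{m-1}\lambda_i=1$, and let $\Lambda\mathbf x=(\lambda_1x_1,\dots,\lambda_{m-1}x_{m-1})$. On $\mathcal H^{m-1}$ define $\mathbf F(\mathbf x)=A_1(x_1)\times\dots\times A_{m-1}(x_{m-1})$ and $\mathbf G=\mathbf K+N_{\mathbf D}$, where $\mathbf K(\Delta(a))=\{\Lambda\Delta(v):v\in A_m(a)\}$ and $\mathbf K(\mathbf x)=\emptyset$ for $\mathbf x\notin\mathbf D$. Put $J^\Lambda_{\lambda\mathbf F}=(\mathrm{Id}+\lambda\Lambda^{-1}\circ\mathbf F)^{-1}$, likewise $J^\Lambda_{\lambda\mathbf G}$, and $$T(\mathbf x)=\{\mathbf x+\mu(\mathbf y-\mathbf z):\ \mathbf z\in J^\Lambda_{\lambda\mathbf F}(\mathbf x),\ \mathbf y\in J^\Lambda_{\lambda\mathbf G}(2\mathbf z-\mathbf x)\},\qquad U(\mathbf x)=J_{\lambda A_m}\Big(\sum_{i=1}^{m-1}\lambda_iR_{\frac{\lambda}{\lambda_i}A_i}(x_i)\Big).$$ Let $\mathcal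 I=\{i\in\{1,\dots,m-1\}:\sigma_i\ne0\}$. **Theorem.** Suppose that one of the following holds. * (A) $\mathcal I\ne\emptyset$ and there are reals $(\delta_i)_{i\in\mathcal I}$ with $\sum_{i\in\mathcal I}\delta_i=1$ such that, for all $i\in\mathcal I$, $\sigma_i+\sigma_m\delta_i>0$ and $1+\frac{\lambda}{\lambda_i}\frac{\sigma_i\sigma_m\delta_i}{\sigma_i+\sigma_m\delta_i}>\frac{\mu}{2}$. * (B) $\mathcal I=\emptyset$ and $\sigma_m\ge0$. Let $(\mathbf x^k,\mathbf z^k,\mathbf y^k)_{k\ge0}$ satisfy $\mathbf z^k\in J^\Lambda_{\lambda\mathbf F}(\mathbf x^k)$, $\mathbf y^k\in J^\Lambda_{\lambda\mathbf G}(2\mathbf z^k-\mathbf x^k)$ and $\mathbf x^{k+1}=\mathbf x^k+\mu(\mathbf y^k-\mathbf z^k)$ for all $k$, with $\mathbf x^0\in\mathcal H^{m-1}$ arbitrary. Then there is $\bar{\mathbf x}\in\operatorname{Fix}T$ such that: 1. $(\mathbf x^k)$ is bounded, $\mathbf x^k\rightharpoonup\bar{\mathbf x}$, $J^\Lambda_{\lambda\mathbf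 F}(\bar{\mathbf x})$ consists of a single point $\bar{\mathbf z}$, and $\bar{\mathbf z}\in\Delta(\operatorname{zer}(\sum_{i=1}^mA_i))$; 2. each set $(\mathrm{Id}-T)(\mathbf x^k)$ consists of a single point, and $\|(\mathrm{Id}-T)\mathbf x^k\|=o(1/\sqrt k)$ as $k\to\infty$; 3. $\|\mathbf y^{k+1}-\mathbf y^k\|=o(1/\sqrt k)$ and $\|\mathbf z^{k+1}-\mathbf z^k\|=o(1/\sqrt k)$ as $k\to\infty$, and $(\mathbf z^k)$ and $(\mathbf y^k)$ are bounded; 4. if (A) holds, or (B) holds with $\sigma_m>0$, then $\mathbf z^k\to\bar{\mathbf z}$ and $\mathbf y^k\to\bar{\mathbf z}$ strongly, $U(\bar{\mathbf x})$ consists of a single point, and $\operatorname{zer}(\sum_{i=1}^mA_i)=U(\bar{\mathbf x})$; 5. if (B) holds with $\sigma_m=0$, then $\mathbf z^k\rightharpoonup\bar{\mathbf z}$ and $\mathbf y^k\rightharpoonup\bar{\mathbf z}$. -/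

import Mathlib

open Filter Topology Asymptotics
open scoped Pointwise RealInnerProductSpace

noncomputable section

namespace DouglasRachford

section Operators

/-! Set-valued operators on a real inner product space `E` are functions `E → Set E`. -/

variable {E : Type*} [NormedAddCommGroup E] [InnerProductSpace ℝ E]

/-- The graph of a set-valued operator. -/
def graph (A : E → Set E) : Set (E × E) := {p | p.2 ∈ A p.1}

/-- `A` is `σ`-monotone. -/
def IsSigmaMonotone (σ : ℝ) (A : E → Set E) : Prop :=
  ∀ p ∈ graph A, ∀ q ∈ graph A, ⟪p.1 - q.1, p.2 - q.2⟫ ≥ σ * ‖p.1 - q.1‖ ^ 2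

/-- `A` is maximal `σ`-monotone: no `σ`-monotone operator has a strictly larger graph. -/
def IsMaximalSigmaMonotone (σ : ℝ) (A : E → Set E) : Prop :=
  IsSigmaMonotone σ A ∧ ¬ ∃ B : E → Set E, IsSigmaMonotone σ B ∧ graph A ⊂ graph B

/-- The inverse of a set-valued operator. -/
def inverse (A : E → Set E) : E → Set E := fun y => {x | y ∈ A x}

/-- The zeros of a set-valued operator. -/
def zer (A : E → Set E) : Set E := {x | (0 : E) ∈ A x}

/-- The fixed points of a set-valued operator. -/
def fixedPts (A : E → Set E) : Set E := {x | x ∈ A x}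

/-- `Id - A` for a set-valued operator `A`. -/
def idSub (A : E → Set E) : E → Set E := fun x => {r | ∃ p ∈ A x, r = x - p}

/-- The resolvent `J_{γA} = (Id + γA)⁻¹`. -/
def setResolvent (γ : ℝ) (A : E → Set E) : E → Set E :=
  inverse fun x => {p | ∃ u ∈ A x, p = x + γ • u}

/-- The reflected resolvent `R_{γA} = 2 J_{γA} - Id`. -/
def reflectedResolvent (γ : ℝ) (A : E → Set E) : E → Set E :=
  fun x => {r | ∃ a ∈ setResolvent γ A x, r = (2 : ℝ) • a - x}

/-- The warped resolvent `J^Λ_{λA} = (Id + λ Λ⁻¹ ∘ A)⁻¹` of `A` for an invertible linear operator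
`Λ`. The set `(Λ⁻¹ ∘ A)(x) = Λ⁻¹(A(x))` is written as the preimage of `A x` under `Λ`. -/
def warpedResolvent (Λ : E →ₗ[ℝ] E) (lam : ℝ) (A : E → Set E) : E → Set E :=
  setResolvent lam fun x => Λ ⁻¹' (A x)

/-- The normal cone operator of a set `C` (empty outside `C`). -/
def normalCone (C : Set E) : E → Set E :=
  fun x => {v | x ∈ C ∧ ∀ c ∈ C, ⟪v, c - x⟫ ≤ 0}

/-- The relaxed Douglas-Rachford operator
`x ↦ {x + μ (y - z) : z ∈ J^Λ_{λF}(x), y ∈ J^Λ_{λG}(2z - x)}`. -/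
def drMap (Λ : E →ₗ[ℝ] E) (lam μ : ℝ) (F G : E → Set E) : E → Set E :=
  fun x => {p | ∃ z ∈ warpedResolvent Λ lam F x,
    ∃ y ∈ warpedResolvent Λ lam G ((2 : ℝ) • z - x), p = x + μ • (y - z)}

/-- `(x, z, y)` is generated by the Douglas-Rachford iteration. -/
def IsDRSequence (Λ : E →ₗ[ℝ] E) (lam μ : ℝ) (F G : E → Set E) (x z y : ℕ → E) : Prop :=
  ∀ k, z k ∈ warpedResolvent Λ lam F (x k) ∧
    y k ∈ warpedResolvent Λ lam G ((2 : ℝ) • z k - x k) ∧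
    x (k + 1) = x k + μ • (y k - z k)

/-- Weak convergence of a sequence. -/
def WeaklyTendsto (x : ℕ → E) (a : E) : Prop :=
  Tendsto (fun k => toWeakSpace ℝ E (x k)) atTop (𝓝 (toWeakSpace ℝ E a))

end Operators

section ProductSpace

variable {H : Type*} [NormedAddCommGroup H] [InnerProductSpace ℝ H] {n : ℕ}

/-- The Hilbert product space `H^n`, with inner product `⟪x, y⟫ = ∑ i, ⟪x i, y i⟫`. -/
abbrev HPow (H : Type*) (n : ℕ) : Type _ := PiLp 2 (fun _ : Fin n => H)

/-- The diagonal embedding `Δ : H → H^n`. -/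
def diagEmb (n : ℕ) (a : H) : HPow H n := WithLp.toLp 2 fun _ => a

/-- The diagonal `D = {x : x₁ = ⋯ = xₙ}` of `H^n`. -/
def diagonal (H : Type*) (n : ℕ) : Set (HPow H n) := {x | ∀ i j, x i = x j}

/-- The operator `Λ x = (w₁ x₁, …, wₙ xₙ)`. -/
def diagOp (w : Fin n → ℝ) : HPow H n →ₗ[ℝ] HPow H n where
  toFun x := WithLp.toLp 2 fun i => w i • x i
  map_add' x y := by ext i; simp
  map_smul' c x := by ext i; simpa using smul_comm (w i) c (x i)

/-! Below, `A : Fin (n + 1) → H → Set H` lists the `m = n + 1` operators: `A₁, …, A_{m-1}` are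
`A i.castSucc` for `i : Fin n`, and `A_m` is `A (Fin.last n)`; the same for `σ`. -/

/-- `F(x) = A₁(x₁) × ⋯ × A_{m-1}(x_{m-1})`. -/
def opF (A : Fin (n + 1) → H → Set H) : HPow H n → Set (HPow H n) :=
  fun x => {u | ∀ i, u i ∈ A i.castSucc (x i)}

/-- `K(x) = {(w₁ v, …, w_{m-1} v) : v ∈ A_m(a)}` if `x = (a, …, a)`, and `K(x) = ∅` if `x` is not
on the diagonal. -/
def opK (w : Fin n → ℝ) (A : Fin (n + 1) → H → Set H) : HPow H n → Set (HPow H n) :=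
  fun x => {p | ∃ a : H, x = diagEmb n a ∧ ∃ v ∈ A (Fin.last n) a, p = diagOp w (diagEmb n v)}

/-- `G = K + N_D`. -/
def opG (w : Fin n → ℝ) (A : Fin (n + 1) → H → Set H) : HPow H n → Set (HPow H n) :=
  fun x => opK w A x + normalCone (diagonal H n) x

/-- `U(x) = J_{λ A_m}(∑_{i<m} w_i R_{(λ/w_i) A_i}(x_i))`, as a set-valued operator. -/
def opU (w : Fin n → ℝ) (lam : ℝ) (A : Fin (n + 1) → H → Set H) : HPow H n → Set H :=
  fun x => {u | ∃ s ∈ ∑ i : Fin n, w i • reflectedResolvent (lam / w i) (A i.castSucc) (x i),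
    u ∈ setResolvent lam (A (Fin.last n)) s}

open Classical in
/-- `I = {i ∈ {1, …, m-1} : σ_i ≠ 0}`. -/
def nonzeroIdx (σ : Fin (n + 1) → ℝ) : Finset (Fin n) := {i | σ i.castSucc ≠ 0}

/-- Condition (A). -/
def CondA (σ : Fin (n + 1) → ℝ) (w : Fin n → ℝ) (lam μ : ℝ) : Prop :=
  (nonzeroIdx σ).Nonempty ∧ ∃ δ : Fin n → ℝ,
    (∀ i ∈ nonzeroIdx σ, 0 < σ i.castSucc + σ (Fin.last n) * δ i) ∧
    ∑ i ∈ nonzeroIdx σ, δ i = 1 ∧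
    ∀ i ∈ nonzeroIdx σ, 1 + lam / w i * ((σ i.castSucc * σ (Fin.last n) * δ i) /
      (σ i.castSucc + σ (Fin.last n) * δ i)) > μ / 2

/-- Condition (B). -/
def CondB (σ : Fin (n + 1) → ℝ) : Prop := nonzeroIdx σ = ∅ ∧ 0 ≤ σ (Fin.last n)

end ProductSpace

end DouglasRachford

end

open DouglasRachford

open Filter Topology Asymptotics
open scoped Pointwise RealInnerProductSpace

namespace DouglasRachford

/-! The coordinate sum annihilates the normal cone of the diagonal, so a step from `x` amounts to
resolvent points `z i` of the first operators and one point `a` of the last, with `y = diagEmb n a`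
(`mem_warpedResolvent_and_iff`). For two steps, adding the σ-monotonicity inequalities gives
`IsDRStep.basic`. The moduli may be negative. Under (A) the modulus of the last operator is
distributed among the others by the weights `δ`, and each pair is combined through
`parallel_sum_le`; the loss is then a multiple of the weighted squared difference of `z` and `a`,
small enough for the relaxation `μ`. This is `Admissible.conical`, and it yields the Fejér estimate
`IsDRStep.fejer` in the norm weighted by `w`.

Compared with a fixed point, that estimate makes distances nonincreasing and residuals square
summable; compared between consecutive iterates, it makes residuals nonincreasing. Olivier's theorem
turns this into the rate, which `IsDRStep.lipschitz` transfers to `z` and `y`.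

If the moduli have positive sum, `IsDRStep.strong` forces `a` to converge strongly to the unique
zero; otherwise all moduli vanish. In both cases demiclosedness (`mem_of_weakLim`) shows that weak
cluster points of `x` are fixed points, and Opial's argument leaves only one. -/

/-! ### Rates for nonincreasing summable sequences -/

/-- Olivier's theorem: a nonincreasing summable nonnegative sequence is `o(1/n)`. -/
theorem tendsto_natCast_mul_of_antitone_summable {b : ℕ → ℝ} (hb0 : ∀ k, 0 ≤ b k)
    (hb : Antitone b) (hs : Summable b) : Tendsto (fun k : ℕ => (k : ℝ) * b k) atTop (𝓝 0) := by
  have h1 := hs.hasSum.tendsto_sum_nat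
  have hhalf : Tendsto (fun k : ℕ => k / 2) atTop atTop :=
    Nat.tendsto_div_const_atTop (by norm_num)
  -- The block from `k / 2` to `k` has at least half of `k` terms, each at least `b k`, and its sum
  -- vanishes in the limit because the series converges.
  have h2 : Tendsto (fun k : ℕ => 2 * (∑ j ∈ Finset.range k, b j
      - ∑ j ∈ Finset.range (k / 2), b j)) atTop (𝓝 0) := by
    have := (h1.sub (h1.comp hhalf)).const_mul 2
    simpa using this
  refine squeeze_zero (fun k => mul_nonneg (Nat.cast_nonneg k) (hb0 k)) (fun k => ?_) h2
  have hle : k / 2 ≤ k := Nat.div_le_self k 2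
  rw [← Finset.sum_Ico_eq_sub _ hle]
  have h3 : ((Finset.Ico (k / 2) k).card : ℕ) • b k ≤ ∑ j ∈ Finset.Ico (k / 2) k, b j :=
    Finset.card_nsmul_le_sum _ _ _ fun j hj => hb (Finset.mem_Ico.1 hj).2.le
  rw [Nat.card_Ico, nsmul_eq_mul] at h3
  have h4 : (k : ℝ) ≤ 2 * ((k - k / 2 : ℕ) : ℝ) := by
    have : k ≤ 2 * (k - k / 2) := by omega
    exact_mod_cast this
  nlinarith [hb0 k]

/-- If `f² ≤ C b` with `b` nonincreasing and summable, then `f = o(1/√k)`. -/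
theorem isLittleO_one_div_sqrt_of_sq_le {f b : ℕ → ℝ} {C : ℝ} (hb0 : ∀ k, 0 ≤ b k)
    (hb : Antitone b) (hs : Summable b) (hf : ∀ k, f k ^ 2 ≤ C * b k) :
    f =o[atTop] (fun k : ℕ => 1 / √(k : ℝ)) := by
  have hpos : ∀ᶠ k : ℕ in atTop, 0 < (k : ℝ) := by
    filter_upwards [eventually_gt_atTop 0] with k hk
    exact_mod_cast hk
  have hne : ∀ᶠ k : ℕ in atTop, 1 / √(k : ℝ) = 0 → f k = 0 := by
    filter_upwards [hpos] with k hk h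
    exact absurd h (one_div_pos.2 (Real.sqrt_pos.2 hk)).ne'
  rw [isLittleO_iff_tendsto' hne]
  have h1 : Tendsto (fun k : ℕ => C * ((k : ℝ) * b k)) atTop (𝓝 0) := by
    simpa using (tendsto_natCast_mul_of_antitone_summable hb0 hb hs).const_mul C
  have h2 : Tendsto (fun k : ℕ => (f k / (1 / √(k : ℝ))) ^ 2) atTop (𝓝 0) := by
    refine squeeze_zero (fun k => sq_nonneg _) (fun k => ?_) h1
    have : (f k / (1 / √(k : ℝ))) ^ 2 = f k ^ 2 * k := by
      rw [one_div, div_inv_eq_mul, mul_pow, Real.sq_sqrt (Nat.cast_nonneg k)]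
    rw [this]
    calc f k ^ 2 * k ≤ C * b k * k := mul_le_mul_of_nonneg_right (hf k) (Nat.cast_nonneg k)
      _ = C * (k * b k) := by ring
  have h3 := h2.sqrt
  simp only [Real.sqrt_sq_eq_abs, Real.sqrt_zero] at h3
  exact (tendsto_zero_iff_abs_tendsto_zero _).2 h3

/-! ### Weak convergence along filters -/

section Weak

variable {E : Type*} [NormedAddCommGroup E] [InnerProductSpace ℝ E] {α : Type*}

/-- Weak convergence along a filter, expressed with the inner product. -/
def WeakLim (l : Filter α) (x : α → E) (a : E) : Prop :=
  ∀ v, Tendsto (fun k => ⟪x k, v⟫) l (𝓝 ⟪a, v⟫)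

theorem weaklyTendsto_iff_weakLim [CompleteSpace E] {x : ℕ → E} {a : E} :
    WeaklyTendsto x a ↔ WeakLim atTop x a := by
  have hinj : Function.Injective ((topDualPairing ℝ E).flip) := by
    intro u v huv
    refine ext_inner_left ℝ fun w => ?_
    exact DFunLike.congr_fun huv (InnerProductSpace.toDual ℝ E w)
  refine (WeakBilin.tendsto_iff_forall_eval_tendsto (B := (topDualPairing ℝ E).flip) hinj).trans
    ⟨fun h v => ?_, fun h φ => ?_⟩
  · have := h (InnerProductSpace.toDual ℝ E v)
    simp_rw [real_inner_comm v]
    exact this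
  · obtain ⟨v, rfl⟩ := (InnerProductSpace.toDual ℝ E).surjective φ
    have := h v
    simp_rw [real_inner_comm v] at this
    exact this

/-- Ultrafilters replace subsequences: a bounded family has a weak limit along each of them, so no
extraction is needed. -/
theorem weakLim_iff_ultrafilter {l : Filter α} {x : α → E} {a : E} :
    WeakLim l x a ↔ ∀ U : Ultrafilter α, (U : Filter α) ≤ l → WeakLim U x a :=
  ⟨fun h _ hU v => (h v).mono_left hU,
    fun h v => (tendsto_iff_ultrafilter _ _ _).2 fun U hU => h U hU v⟩

theorem WeakLim.of_tendsto {l : Filter α} {x : α → E} {a : E} (h : Tendsto x l (𝓝 a)) :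
    WeakLim l x a := fun _ => h.inner tendsto_const_nhds

theorem WeakLim.add {l : Filter α} {x y : α → E} {a b : E} (hx : WeakLim l x a)
    (hy : WeakLim l y b) : WeakLim l (fun k => x k + y k) (a + b) := fun v => by
  simpa only [inner_add_left] using (hx v).add (hy v)

theorem WeakLim.sub {l : Filter α} {x y : α → E} {a b : E} (hx : WeakLim l x a)
    (hy : WeakLim l y b) : WeakLim l (fun k => x k - y k) (a - b) := fun v => by
  simpa only [inner_sub_left] using (hx v).sub (hy v)

theorem WeakLim.const_smul {l : Filter α} {x : α → E} {a : E} (hx : WeakLim l x a) (c : ℝ) :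
    WeakLim l (fun k => c • x k) (c • a) := fun v => by
  simpa only [real_inner_smul_left] using (hx v).const_mul c

theorem WeakLim.sum {ι : Type*} (s : Finset ι) {l : Filter α} {x : ι → α → E} {a : ι → E}
    (hx : ∀ i, WeakLim l (x i) (a i)) :
    WeakLim l (fun k => ∑ i ∈ s, x i k) (∑ i ∈ s, a i) := fun v => by
  simpa only [sum_inner] using tendsto_finsetSum s fun i _ => hx i v

theorem WeakLim.unique {l : Filter α} [l.NeBot] {x : α → E} {a b : E} (ha : WeakLim l x a)
    (hb : WeakLim l x b) : a = b :=
  ext_inner_right ℝ fun v => tendsto_nhds_unique (ha v) (hb v)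

/-- Bounded families in a Hilbert space converge weakly along ultrafilters. -/
theorem exists_weakLim_of_bounded [CompleteSpace E] (U : Ultrafilter α) {x : α → E} {C : ℝ}
    (hC : ∀ k, ‖x k‖ ≤ C) : ∃ a, WeakLim U x a := by
  have hb : ∀ v k, ⟪x k, v⟫ ∈ Set.Icc (-(C * ‖v‖)) (C * ‖v‖) := fun v k =>
    abs_le.1 ((abs_real_inner_le_norm _ _).trans
      (mul_le_mul_of_nonneg_right (hC k) (norm_nonneg v)))
  have hlim : ∀ v, ∃ c ∈ Set.Icc (-(C * ‖v‖)) (C * ‖v‖),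
      Tendsto (fun k => ⟪x k, v⟫) U (𝓝 c) := fun v =>
    isCompact_Icc.ultrafilter_le_nhds (U.map fun k => ⟪x k, v⟫)
      (le_principal_iff.2 (Filter.mem_map.2 (Filter.univ_mem' (hb v))))
  choose f hf hfl using hlim
  -- The scalar limits are linear in `v` and bounded by `C * ‖v‖`, so the Riesz representation
  -- supplies the weak limit.
  let L : E →ₗ[ℝ] ℝ :=
    { toFun := f
      map_add' := fun v w => tendsto_nhds_unique (hfl (v + w))
        (by simpa only [inner_add_right] using (hfl v).add (hfl w))
      map_smul' := fun c v => tendsto_nhds_unique (hfl (c • v))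
        (by simpa only [real_inner_smul_right, RingHom.id_apply, smul_eq_mul]
          using (hfl v).const_mul c) }
  let φ : E →L[ℝ] ℝ := L.mkContinuous C fun v => abs_le.2 (hf v)
  refine ⟨(InnerProductSpace.toDual ℝ E).symm φ, fun v => ?_⟩
  rw [InnerProductSpace.toDual_symm_apply]
  exact hfl v

theorem tendsto_inner_zero_of_bounded {l : Filter α} {s t : α → E} {C : ℝ}
    (hs : Tendsto s l (𝓝 0)) (ht : ∀ k, ‖t k‖ ≤ C) : Tendsto (fun k => ⟪s k, t k⟫) l (𝓝 0) := by
  have h := (tendsto_norm_zero.comp hs).mul_const C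
  rw [zero_mul] at h
  refine squeeze_zero_norm (fun k => ?_) h
  exact (norm_inner_le_norm _ _).trans (mul_le_mul_of_nonneg_left (ht k) (norm_nonneg _))

end Weak

/-! ### Maximality and demiclosedness -/

section Maximal

variable {E : Type*} [NormedAddCommGroup E] [InnerProductSpace ℝ E]

theorem IsSigmaMonotone.le_inner {σ : ℝ} {A : E → Set E} (hA : IsSigmaMonotone σ A)
    {x u p q : E} (hu : u ∈ A x) (hq : q ∈ A p) : σ * ‖x - p‖ ^ 2 ≤ ⟪x - p, u - q⟫ :=
  hA (x, u) hu (p, q) hq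

/-- A point monotonically related to the graph of a maximal operator belongs to it. -/
theorem IsMaximalSigmaMonotone.mem_of_forall {σ : ℝ} {A : E → Set E}
    (hA : IsMaximalSigmaMonotone σ A) {x u : E}
    (h : ∀ p, ∀ q ∈ A p, σ * ‖x - p‖ ^ 2 ≤ ⟪x - p, u - q⟫) : u ∈ A x := by
  by_contra hu
  refine hA.2 ⟨fun y => A y ∪ {v | y = x ∧ v = u}, ?_, ?_⟩
  · rintro ⟨p, q⟩ (hq | ⟨hp, hq⟩) ⟨p', q'⟩ (hq' | ⟨hp', hq'⟩)
    · exact hA.1 (p, q) hq (p', q') hq'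
    · simp only at hp' hq' ⊢
      subst hp' hq'
      rw [norm_sub_rev, ← inner_neg_neg, neg_sub, neg_sub]
      exact h p q hq
    · simp only at hp hq ⊢
      subst hp hq
      exact h p' q' hq'
    · simp only at hp hq hp' hq' ⊢
      subst hp hq hp' hq'
      simp
  · refine ⟨fun p hp => Or.inl hp, fun hsub => hu ?_⟩
    have : ((x, u) : E × E) ∈ graph A := hsub (Or.inr ⟨rfl, rfl⟩)
    exact this

/-- A product of maximal operators is maximal. -/
theorem mem_of_forall_sum_le {ι : Type*} [Fintype ι] {A : ι → E → Set E} {σ : ι → ℝ}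
    (hA : ∀ i, IsMaximalSigmaMonotone (σ i) (A i)) {x u : ι → E}
    (h : ∀ p q : ι → E, (∀ i, q i ∈ A i (p i)) →
      0 ≤ ∑ i, (⟪x i - p i, u i - q i⟫ - σ i * ‖x i - p i‖ ^ 2)) (i : ι) : u i ∈ A i (x i) := by
  -- An index whose pair lies in its graph is tested against itself and contributes zero; any other
  -- index has a strictly negative test pair. One bad index would therefore make the whole sum
  -- negative.
  have key : ∀ j, ∃ p, ∃ q ∈ A j p, ⟪x j - p, u j - q⟫ - σ j * ‖x j - p‖ ^ 2 ≤ 0 ∧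
      (u j ∉ A j (x j) → ⟪x j - p, u j - q⟫ - σ j * ‖x j - p‖ ^ 2 < 0) := by
    intro j
    by_cases hj : u j ∈ A j (x j)
    · exact ⟨x j, u j, hj, by simp, fun h => absurd hj h⟩
    · have : ¬ ∀ p, ∀ q ∈ A j p, σ j * ‖x j - p‖ ^ 2 ≤ ⟪x j - p, u j - q⟫ :=
        fun h => hj ((hA j).mem_of_forall h)
      push Not at this
      obtain ⟨p, q, hq, hlt⟩ := this
      exact ⟨p, q, hq, by linarith, fun _ => by linarith⟩
  choose p q hq hle hlt using key
  by_contra hi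
  have := Finset.sum_lt_sum (s := Finset.univ) (fun j _ => hle j) ⟨i, Finset.mem_univ i, hlt i hi⟩
  rw [Finset.sum_const_zero] at this
  exact absurd (h p q hq) (not_le.2 this)

/-- Demiclosedness principle for a finite family of maximal operators. -/
theorem mem_of_weakLim {ι α : Type*} [Fintype ι] {A : ι → E → Set E} {σ : ι → ℝ}
    (hA : ∀ i, IsMaximalSigmaMonotone (σ i) (A i)) {l : Filter α} [l.NeBot]
    {z u : ι → α → E} {a : α → E} {ζ : E} {ub : ι → E} {C : ℝ}
    (hmem : ∀ i k, u i k ∈ A i (z i k))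
    (hz : ∀ i, WeakLim l (z i) ζ) (hu : ∀ i, WeakLim l (u i) (ub i))
    (hza : ∀ i, Tendsto (fun k => z i k - a k) l (𝓝 0))
    (hsum : Tendsto (fun k => ∑ i, u i k) l (𝓝 0))
    (haC : ∀ k, ‖a k‖ ≤ C) (huC : ∀ i, ∃ D, ∀ k, ‖u i k‖ ≤ D)
    (hσ : ∀ i p, Tendsto (fun k => σ i * ‖z i k - p‖ ^ 2) l (𝓝 (σ i * ‖ζ - p‖ ^ 2))) :
    ∑ i, ub i = 0 ∧ ∀ i, ub i ∈ A i ζ := by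
  have hub : ∑ i, ub i = 0 := (WeakLim.sum Finset.univ hu).unique (WeakLim.of_tendsto hsum)
  refine ⟨hub, fun i => mem_of_forall_sum_le hA (x := fun _ => ζ) (u := ub) (fun p q hq => ?_) i⟩
  -- The individual inner products of weakly convergent families need not converge. Their sum does:
  -- writing `z i = a + (z i - a)` leaves only products of a strongly vanishing factor with a
  -- bounded one.
  have h1 : Tendsto (fun k => ∑ i, ⟪z i k, u i k⟫) l (𝓝 0) := by
    have e : ∀ k, ∑ i, ⟪z i k, u i k⟫ = ∑ i, ⟪z i k - a k, u i k⟫ + ⟪∑ i, u i k, a k⟫ := by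
      intro k
      rw [sum_inner, ← Finset.sum_add_distrib]
      refine Finset.sum_congr rfl fun i _ => ?_
      rw [inner_sub_left, real_inner_comm (a k)]
      ring
    simp_rw [e]
    have := (tendsto_finsetSum Finset.univ fun i _ =>
      tendsto_inner_zero_of_bounded (hza i) (huC i).choose_spec).add
        (tendsto_inner_zero_of_bounded hsum haC)
    simpa using this
  have h2 : Tendsto (fun k => ∑ i, ⟪z i k, u i k⟫ +
      ∑ i, (-⟪z i k, q i⟫ - ⟪u i k, p i⟫ + ⟪p i, q i⟫ - σ i * ‖z i k - p i‖ ^ 2)) l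
      (𝓝 (0 + ∑ i, (-⟪ζ, q i⟫ - ⟪ub i, p i⟫ + ⟪p i, q i⟫ - σ i * ‖ζ - p i‖ ^ 2))) :=
    h1.add (tendsto_finsetSum Finset.univ fun i _ =>
      (((hz i (q i)).neg.sub (hu i (p i))).add tendsto_const_nhds).sub (hσ i (p i)))
  have h3 := ge_of_tendsto' h2 (b := 0) fun k => by
    rw [← Finset.sum_add_distrib]
    refine Finset.sum_nonneg fun i _ => ?_
    have := (hA i).1.le_inner (hmem i k) (hq i)
    rw [inner_sub_left, inner_sub_right, inner_sub_right, real_inner_comm (u i k) (p i)] at this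
    linarith
  -- This supplies the missing term `⟪ζ, ub i⟫` in the limiting monotonicity inequality, which holds
  -- only after summation.
  have h4 : ∑ i, ⟪ζ, ub i⟫ = 0 := by rw [← inner_sum, hub, inner_zero_right]
  refine h3.trans_eq ?_
  rw [← h4, ← Finset.sum_add_distrib]
  refine Finset.sum_congr rfl fun i _ => ?_
  rw [inner_sub_left, inner_sub_right, inner_sub_right, real_inner_comm (ub i) (p i)]
  ring

end Maximal

/-! ### Resolvents on the product space -/

section Product

@[simp] theorem diagEmb_apply {H : Type*} {n : ℕ} (a : H) (i : Fin n) : diagEmb n a i = a := rfl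

theorem norm_apply_le {H : Type*} [NormedAddCommGroup H] {n : ℕ} (x : HPow H n) (i : Fin n) :
    ‖x i‖ ≤ ‖x‖ := PiLp.norm_apply_le x i

theorem norm_sq_eq_sum {H : Type*} [NormedAddCommGroup H] {n : ℕ} (x : HPow H n) :
    ‖x‖ ^ 2 = ∑ i, ‖x i‖ ^ 2 :=
  PiLp.norm_sq_eq_of_L2 _ x

variable {H : Type*} [NormedAddCommGroup H] [InnerProductSpace ℝ H] {n : ℕ}

@[simp] theorem diagOp_apply (w : Fin n → ℝ) (x : HPow H n) (i : Fin n) :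
    diagOp w x i = w i • x i := rfl

theorem weakLim_pi_iff {α : Type*} {l : Filter α} {x : α → HPow H n} {a : HPow H n} :
    WeakLim l x a ↔ ∀ i, WeakLim l (fun k => x k i) (a i) := by
  refine ⟨fun h i v => ?_, fun h v => ?_⟩
  · have := h (PiLp.single 2 i v)
    simpa [PiLp.inner_apply, Pi.single_apply, apply_ite] using this
  · simp only [PiLp.inner_apply]
    exact tendsto_finsetSum _ fun i _ => h i (v i)

/-- The normal cone of a subspace is its orthogonal complement. Moving from `a` by `∑ i, q i` along
the diagonal tests `q` against its own sum. -/
theorem mem_normalCone_diagonal_iff (hn : 1 ≤ n) {a : H} {q : HPow H n} :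
    q ∈ normalCone (diagonal H n) (diagEmb n a) ↔ ∑ i, q i = 0 := by
  constructor
  · rintro ⟨-, h⟩
    have h1 := h (diagEmb n (a + ∑ i, q i)) fun i j => rfl
    have h2 : ⟪q, diagEmb n (a + ∑ i, q i) - diagEmb n a⟫ = ⟪∑ i, q i, ∑ i, q i⟫ := by
      rw [PiLp.inner_apply, sum_inner]
      simp
    rw [h2] at h1
    exact inner_self_eq_zero.1 (le_antisymm h1 real_inner_self_nonneg)
  · intro h
    refine ⟨fun i j => rfl, fun c hc => le_of_eq ?_⟩
    have : ∀ i, (c - diagEmb n a) i = c ⟨0, hn⟩ - a := fun i => by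
      rw [hc ⟨0, hn⟩ i]; simp
    rw [PiLp.inner_apply]
    simp_rw [this]
    rw [← sum_inner, h, inner_zero_left]

theorem mem_setResolvent_iff {E : Type*} [NormedAddCommGroup E] [InnerProductSpace ℝ E]
    {A : E → Set E} {γ : ℝ} (hγ : γ ≠ 0) {x z : E} :
    z ∈ setResolvent γ A x ↔ γ⁻¹ • (x - z) ∈ A z := by
  constructor
  · rintro ⟨u, hu, rfl⟩
    simpa [smul_smul, hγ] using hu
  · intro h
    exact ⟨_, h, by simp [smul_smul, hγ]⟩

theorem mem_warpedResolvent_iff {E : Type*} [NormedAddCommGroup E] [InnerProductSpace ℝ E]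
    {Λ : E →ₗ[ℝ] E} {A : E → Set E} {γ : ℝ} (hγ : γ ≠ 0) {x z : E} :
    z ∈ warpedResolvent Λ γ A x ↔ Λ (γ⁻¹ • (x - z)) ∈ A z :=
  mem_setResolvent_iff hγ

theorem mem_warpedResolvent_opF_iff {A : Fin (n + 1) → H → Set H} {w : Fin n → ℝ} {lam : ℝ}
    (hlam : lam ≠ 0) {x z : HPow H n} :
    z ∈ warpedResolvent (diagOp w) lam (opF A) x ↔
      ∀ i : Fin n, (w i / lam) • (x i - z i) ∈ A i.castSucc (z i) := by
  rw [mem_warpedResolvent_iff hlam]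
  refine forall_congr' fun i => ?_
  rw [diagOp_apply, PiLp.smul_apply, smul_smul, PiLp.sub_apply, div_eq_mul_inv]

/-- Summing coordinates removes the normal component and, as the weights add up to one, leaves a
single resolvent inclusion in `H`. Conversely, the normal component is recovered as the difference.
-/
theorem mem_warpedResolvent_opG_iff (hn : 1 ≤ n) {A : Fin (n + 1) → H → Set H} {w : Fin n → ℝ}
    (hwsum : ∑ i, w i = 1) {lam : ℝ} (hlam : lam ≠ 0) {s y : HPow H n} :
    y ∈ warpedResolvent (diagOp w) lam (opG w A) s ↔
      ∃ a, y = diagEmb n a ∧ lam⁻¹ • (∑ i, w i • s i - a) ∈ A (Fin.last n) a := by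
  rw [mem_warpedResolvent_iff hlam]
  have hsum : ∀ a u : H, ∑ i, (diagOp w (lam⁻¹ • (s - diagEmb n a)) - diagOp w (diagEmb n u)) i
      = lam⁻¹ • (∑ i, w i • s i - a) - u := by
    intro a u
    simp only [PiLp.sub_apply, diagOp_apply, PiLp.smul_apply, diagEmb_apply, smul_comm _ lam⁻¹,
      smul_sub, Finset.sum_sub_distrib, ← Finset.smul_sum, ← Finset.sum_smul, hwsum, one_smul]
  constructor
  · rintro ⟨p, ⟨a, rfl, u, hu, rfl⟩, q, hq, hpq⟩
    refine ⟨a, rfl, ?_⟩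
    rw [mem_normalCone_diagonal_iff hn] at hq
    have hq' : q = diagOp w (lam⁻¹ • (s - diagEmb n a)) - diagOp w (diagEmb n u) :=
      eq_sub_of_add_eq' hpq
    rw [hq', hsum, sub_eq_zero] at hq
    rwa [hq]
  · rintro ⟨a, rfl, hu⟩
    refine ⟨_, ⟨a, rfl, _, hu, rfl⟩, _, ?_, add_sub_cancel _ _⟩
    rw [mem_normalCone_diagonal_iff hn, hsum, sub_self]

/-- `z` and `Δ a` are the two resolvent points of a Douglas-Rachford step from `x`. -/
def IsDRStep (A : Fin (n + 1) → H → Set H) (w : Fin n → ℝ) (lam : ℝ) (x z : HPow H n) (a : H) :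
    Prop :=
  (∀ i : Fin n, (w i / lam) • (x i - z i) ∈ A i.castSucc (z i)) ∧
    lam⁻¹ • (∑ i, w i • ((2 : ℝ) • z i - x i) - a) ∈ A (Fin.last n) a

theorem mem_warpedResolvent_and_iff (hn : 1 ≤ n) {A : Fin (n + 1) → H → Set H} {w : Fin n → ℝ}
    (hwsum : ∑ i, w i = 1) {lam : ℝ} (hlam : lam ≠ 0) {x z y : HPow H n} :
    z ∈ warpedResolvent (diagOp w) lam (opF A) x ∧
        y ∈ warpedResolvent (diagOp w) lam (opG w A) ((2 : ℝ) • z - x) ↔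
      ∃ a, y = diagEmb n a ∧ IsDRStep A w lam x z a := by
  rw [mem_warpedResolvent_opF_iff hlam, mem_warpedResolvent_opG_iff hn hwsum hlam]
  constructor
  · rintro ⟨h1, a, rfl, h2⟩
    exact ⟨a, rfl, h1, h2⟩
  · rintro ⟨a, rfl, h1, h2⟩
    exact ⟨h1, a, rfl, h2⟩

end Product

/-! ### Estimates for a pair of steps -/

section Estimates

variable {H : Type*} [NormedAddCommGroup H] [InnerProductSpace ℝ H] {n : ℕ}
  {A : Fin (n + 1) → H → Set H} {σ : Fin (n + 1) → ℝ} {w : Fin n → ℝ} {lam : ℝ}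
  {x z x' z' : HPow H n} {a a' : H}

/-- The squared norm weighted by `w`. -/
def wsq {H : Type*} [NormedAddCommGroup H] (w : Fin n → ℝ) (x : HPow H n) : ℝ :=
  ∑ i, w i * ‖x i‖ ^ 2

theorem wsq_nonneg {H : Type*} [NormedAddCommGroup H] (hw : ∀ i, 0 < w i) (x : HPow H n) :
    0 ≤ wsq w x :=
  Finset.sum_nonneg fun i _ => mul_nonneg (hw i).le (sq_nonneg _)

theorem wsq_smul (c : ℝ) (x : HPow H n) : wsq w (c • x) = c ^ 2 * wsq w x := by
  simp only [wsq, PiLp.smul_apply, norm_smul, mul_pow, Real.norm_eq_abs, sq_abs, Finset.mul_sum]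
  exact Finset.sum_congr rfl fun i _ => by ring

theorem norm_sq_le_wsq {H : Type*} [NormedAddCommGroup H] (hw : ∀ i, 0 < w i) (x : HPow H n) :
    ‖x‖ ^ 2 ≤ (∑ i, (w i)⁻¹) * wsq w x := by
  rw [norm_sq_eq_sum, Finset.sum_mul]
  refine Finset.sum_le_sum fun i _ => ?_
  have h := Finset.single_le_sum (f := fun i => w i * ‖x i‖ ^ 2)
    (fun j _ => mul_nonneg (hw j).le (sq_nonneg _)) (Finset.mem_univ i)
  calc ‖x i‖ ^ 2 = (w i)⁻¹ * (w i * ‖x i‖ ^ 2) := by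
        rw [← mul_assoc, inv_mul_cancel₀ (hw i).ne', one_mul]
    _ ≤ (w i)⁻¹ * wsq w x := mul_le_mul_of_nonneg_left h (inv_nonneg.2 (hw i).le)

theorem IsDRStep.inner_fst (hA : ∀ i, IsMaximalSigmaMonotone (σ i) (A i)) (hlam : 0 < lam)
    (h : IsDRStep A w lam x z a) (h' : IsDRStep A w lam x' z' a') (i : Fin n) :
    lam * (σ i.castSucc * ‖z i - z' i‖ ^ 2) ≤
      w i * (⟪z i - z' i, x i - x' i⟫ - ‖z i - z' i‖ ^ 2) := by
  have h1 := (hA i.castSucc).1.le_inner (h.1 i) (h'.1 i)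
  have e : (w i / lam) • (x i - z i) - (w i / lam) • (x' i - z' i)
      = (w i / lam) • ((x i - x' i) - (z i - z' i)) := by
    rw [← smul_sub]; congr 1; abel
  rw [e, real_inner_smul_right, inner_sub_right _ (x i - x' i), real_inner_self_eq_norm_sq] at h1
  calc _ ≤ _ := mul_le_mul_of_nonneg_left h1 hlam.le
    _ = _ := by field_simp

theorem IsDRStep.inner_snd (hA : ∀ i, IsMaximalSigmaMonotone (σ i) (A i)) (hlam : 0 < lam)
    (h : IsDRStep A w lam x z a) (h' : IsDRStep A w lam x' z' a') :
    lam * (σ (Fin.last n) * ‖a - a'‖ ^ 2) ≤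
      ⟪a - a', ∑ i, w i • ((2 : ℝ) • (z i - z' i) - (x i - x' i))⟫ - ‖a - a'‖ ^ 2 := by
  have h1 := (hA (Fin.last n)).1.le_inner h.2 h'.2
  have e : lam⁻¹ • (∑ i, w i • ((2 : ℝ) • z i - x i) - a)
      - lam⁻¹ • (∑ i, w i • ((2 : ℝ) • z' i - x' i) - a')
      = lam⁻¹ • (∑ i, w i • ((2 : ℝ) • (z i - z' i) - (x i - x' i)) - (a - a')) := by
    have : ∑ i, w i • ((2 : ℝ) • (z i - z' i) - (x i - x' i)) =
        ∑ i, w i • ((2 : ℝ) • z i - x i) - ∑ i, w i • ((2 : ℝ) • z' i - x' i) := by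
      rw [← Finset.sum_sub_distrib]
      refine Finset.sum_congr rfl fun i _ => ?_
      module
    rw [this]
    module
  rw [e, real_inner_smul_right, inner_sub_right, real_inner_self_eq_norm_sq] at h1
  calc _ ≤ _ := mul_le_mul_of_nonneg_left h1 hlam.le
    _ = _ := by field_simp

/-- The basic estimate for two Douglas-Rachford steps. -/
theorem IsDRStep.basic (hA : ∀ i, IsMaximalSigmaMonotone (σ i) (A i)) (hlam : 0 < lam)
    (hwsum : ∑ i, w i = 1)
    (h : IsDRStep A w lam x z a) (h' : IsDRStep A w lam x' z' a') :
    lam * (∑ i : Fin n, σ i.castSucc * ‖z i - z' i‖ ^ 2 + σ (Fin.last n) * ‖a - a'‖ ^ 2)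
      + ∑ i, w i * ‖(z i - z' i) - (a - a')‖ ^ 2 ≤
      ∑ i, w i * ⟪(z i - z' i) - (a - a'), x i - x' i⟫ := by
  have h1 := Finset.sum_le_sum fun i (_ : i ∈ Finset.univ) => h.inner_fst hA hlam h' i
  have h2 := h.inner_snd hA hlam h'
  have h3 : ⟪a - a', ∑ i, w i • ((2 : ℝ) • (z i - z' i) - (x i - x' i))⟫ - ‖a - a'‖ ^ 2
      = ∑ i, w i * (2 * ⟪z i - z' i, a - a'⟫ - ⟪a - a', x i - x' i⟫ - ‖a - a'‖ ^ 2) := by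
    simp only [mul_sub, Finset.sum_sub_distrib, ← Finset.sum_mul, hwsum, one_mul, inner_sum,
      real_inner_smul_right, inner_sub_right, real_inner_comm (a - a')]
  rw [h3] at h2
  rw [← Finset.mul_sum] at h1
  rw [mul_add]
  refine (add_le_add_left (add_le_add h1 h2) _).trans_eq ?_
  rw [← Finset.sum_add_distrib, ← Finset.sum_add_distrib]
  refine Finset.sum_congr rfl fun i _ => ?_
  rw [norm_sub_sq_real (z i - z' i) (a - a'), inner_sub_left (z i - z' i)]
  ring

/-- Coefficient conditions under which the relaxed Douglas-Rachford operator is well behaved. -/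
structure Admissible (H : Type*) [NormedAddCommGroup H] (σ : Fin (n + 1) → ℝ) (w : Fin n → ℝ)
    (lam μ : ℝ) : Prop where
  fst : ∀ i : Fin n, 0 < w i + lam * σ i.castSucc
  snd : 0 < 1 + lam * σ (Fin.last n)
  conical : ∃ κ, μ / 2 < κ ∧ ∀ (p : Fin n → H) (q : H), (κ - 1) * ∑ i, w i * ‖p i - q‖ ^ 2 ≤
    lam * (∑ i : Fin n, σ i.castSucc * ‖p i‖ ^ 2 + σ (Fin.last n) * ‖q‖ ^ 2)

/-- Expanding the square gives a cross term with factor `-2 * μ` and a residual term with factor `μ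
^ 2`. By `IsDRStep.basic` and `conical`, the cross sum is at least `κ` times the residual, whence `c
= μ * (2 * κ - μ)`. -/
theorem IsDRStep.fejer {μ : ℝ} (hA : ∀ i, IsMaximalSigmaMonotone (σ i) (A i)) (hlam : 0 < lam)
    (hwsum : ∑ i, w i = 1) (hμ : 0 < μ) (had : Admissible H σ w lam μ) :
    ∃ c > 0, ∀ {x z x' z' : HPow H n} {a a' : H}, IsDRStep A w lam x z a →
      IsDRStep A w lam x' z' a' →
      wsq w ((x + μ • (diagEmb n a - z)) - (x' + μ • (diagEmb n a' - z')))
        + c * wsq w ((z - diagEmb n a) - (z' - diagEmb n a')) ≤ wsq w (x - x') := by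
  obtain ⟨κ, hκ, hκ2⟩ := had.conical
  refine ⟨μ * (2 * κ - μ), mul_pos hμ (by linarith), fun {x z x' z' a a'} h h' => ?_⟩
  have h1 := h.basic hA hlam hwsum h'
  have h2 := hκ2 (fun i => z i - z' i) (a - a')
  have h3 : wsq w ((x + μ • (diagEmb n a - z)) - (x' + μ • (diagEmb n a' - z')))
      = wsq w (x - x') - 2 * μ * ∑ i, w i * ⟪(z i - z' i) - (a - a'), x i - x' i⟫
        + μ ^ 2 * ∑ i, w i * ‖(z i - z' i) - (a - a')‖ ^ 2 := by
    simp only [wsq, Finset.mul_sum]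
    rw [← Finset.sum_sub_distrib, ← Finset.sum_add_distrib]
    refine Finset.sum_congr rfl fun i _ => ?_
    have e : ((x + μ • (diagEmb n a - z)) - (x' + μ • (diagEmb n a' - z'))) i
        = (x i - x' i) - μ • ((z i - z' i) - (a - a')) := by
      simp only [PiLp.sub_apply, PiLp.add_apply, PiLp.smul_apply, diagEmb_apply]
      module
    rw [e, norm_sub_sq_real, real_inner_smul_right, norm_smul, mul_pow, Real.norm_eq_abs, sq_abs,
      real_inner_comm (x i - x' i), PiLp.sub_apply]
    ring
  have h4 : wsq w ((z - diagEmb n a) - (z' - diagEmb n a'))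
      = ∑ i, w i * ‖(z i - z' i) - (a - a')‖ ^ 2 := by
    refine Finset.sum_congr rfl fun i _ => ?_
    simp only [PiLp.sub_apply, diagEmb_apply]
    rw [sub_sub_sub_comm]
  rw [h3, h4]
  nlinarith

/-- Positivity of the coefficients in `Admissible.fst` and `Admissible.snd` makes each resolvent
Lipschitz by Cauchy–Schwarz. The case `x = x'` gives uniqueness of the step. -/
theorem IsDRStep.lipschitz {μ : ℝ} (hA : ∀ i, IsMaximalSigmaMonotone (σ i) (A i)) (hlam : 0 < lam)
    (hw : ∀ i, 0 < w i) (hwsum : ∑ i, w i = 1) (had : Admissible H σ w lam μ) :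
    ∃ L ≥ 0, ∀ {x z x' z' : HPow H n} {a a' : H}, IsDRStep A w lam x z a →
      IsDRStep A w lam x' z' a' →
      ‖z - z'‖ ≤ L * ‖x - x'‖ ∧ ‖a - a'‖ ≤ L * ‖x - x'‖ := by
  have aux : ∀ {c d s t : ℝ}, 0 < c → 0 ≤ s → 0 ≤ d * t → c * s ^ 2 ≤ d * (s * t) →
      s ≤ d / c * t := by
    intro c d s t hc hs ht h
    rw [div_mul_eq_mul_div, le_div_iff₀ hc]
    rcases hs.eq_or_lt with rfl | hs
    · simpa using ht
    · nlinarith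
  -- A sum of the coordinate Lipschitz constants, used as a crude common bound for all of them.
  set M : ℝ := ∑ i : Fin n, w i / (w i + lam * σ i.castSucc) with hM
  set N : ℝ := 1 + lam * σ (Fin.last n) with hN
  have hNpos : 0 < N := had.snd
  have hMi : ∀ i : Fin n, 0 ≤ w i / (w i + lam * σ i.castSucc) := fun i =>
    div_nonneg (hw i).le (had.fst i).le
  have hM0 : 0 ≤ M := Finset.sum_nonneg fun i _ => hMi i
  have hL2 : 0 ≤ 1 / N * (2 * M + 1) := by positivity
  have hL1 : 0 ≤ n * M := by positivity
  refine ⟨n * M + 1 / N * (2 * M + 1), add_nonneg hL1 hL2, fun {x z x' z' a a'} h h' => ?_⟩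
  have hz : ∀ i, ‖z i - z' i‖ ≤ M * ‖x - x'‖ := by
    intro i
    have h1 := h.inner_fst hA hlam h' i
    have h2 := real_inner_le_norm (z i - z' i) (x i - x' i)
    have h3 : ‖z i - z' i‖ ≤ w i / (w i + lam * σ i.castSucc) * ‖x i - x' i‖ := by
      refine aux (had.fst i) (norm_nonneg _) (mul_nonneg (hw i).le (norm_nonneg _)) ?_
      have := mul_le_mul_of_nonneg_left h2 (hw i).le
      linarith
    refine h3.trans (mul_le_mul ?_ (norm_apply_le (x - x') i) (norm_nonneg _) hM0)
    exact Finset.single_le_sum (f := fun i : Fin n => w i / (w i + lam * σ i.castSucc))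
      (fun j _ => hMi j) (Finset.mem_univ i)
  constructor
  · have h1 : ‖z - z'‖ ≤ n * M * ‖x - x'‖ := by
      have h2 : ‖z - z'‖ ^ 2 ≤ (n * M * ‖x - x'‖) ^ 2 := by
        rw [norm_sq_eq_sum]
        calc ∑ i, ‖(z - z') i‖ ^ 2 ≤ ∑ _i : Fin n, (M * ‖x - x'‖) ^ 2 :=
              Finset.sum_le_sum fun i _ => pow_le_pow_left₀ (norm_nonneg _) (hz i) 2
          _ = n * (M * ‖x - x'‖) ^ 2 := by simp
          _ ≤ (n : ℝ) ^ 2 * (M * ‖x - x'‖) ^ 2 := by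
              refine mul_le_mul_of_nonneg_right ?_ (sq_nonneg _)
              exact_mod_cast Nat.le_self_pow two_ne_zero n
          _ = (n * M * ‖x - x'‖) ^ 2 := by ring
      exact le_of_sq_le_sq h2 (by positivity)
    refine h1.trans (mul_le_mul_of_nonneg_right ?_ (norm_nonneg _))
    linarith
  · have h1 := h.inner_snd hA hlam h'
    have h2 := real_inner_le_norm (a - a')
      (∑ i, w i • ((2 : ℝ) • (z i - z' i) - (x i - x' i)))
    have h3 : ‖∑ i, w i • ((2 : ℝ) • (z i - z' i) - (x i - x' i))‖
        ≤ (2 * M + 1) * ‖x - x'‖ := by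
      calc _ ≤ ∑ i, w i * ((2 * M + 1) * ‖x - x'‖) := by
            refine norm_sum_le_of_le _ fun i _ => ?_
            rw [norm_smul, Real.norm_of_nonneg (hw i).le]
            refine mul_le_mul_of_nonneg_left ((norm_sub_le _ _).trans ?_) (hw i).le
            rw [norm_smul, Real.norm_of_nonneg zero_le_two]
            have := hz i
            have := norm_apply_le (x - x') i
            rw [PiLp.sub_apply] at this
            linarith
        _ = _ := by rw [← Finset.sum_mul, hwsum, one_mul]
    have h4 : ‖a - a'‖ ≤ 1 / N * ((2 * M + 1) * ‖x - x'‖) := by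
      refine aux hNpos (norm_nonneg _) (by positivity) ?_
      have := mul_le_mul_of_nonneg_left h3 (norm_nonneg (a - a'))
      rw [hN]
      linarith
    rw [← mul_assoc] at h4
    refine h4.trans (mul_le_mul_of_nonneg_right ?_ (norm_nonneg _))
    linarith

end Estimates

/-! ### Conditions (A) and (B) imply admissibility -/

section Conditions

variable {n : ℕ} {σ : Fin (n + 1) → ℝ} {w : Fin n → ℝ} {lam μ : ℝ}

theorem mem_nonzeroIdx {i : Fin n} : i ∈ nonzeroIdx σ ↔ σ i.castSucc ≠ 0 := by
  simp [nonzeroIdx]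

theorem CondA.sum_pos (h : CondA σ w lam μ) : 0 < ∑ i, σ i := by
  obtain ⟨hne, δ, hpos, hδ, -⟩ := h
  have h1 := Finset.sum_pos hpos hne
  rw [Finset.sum_add_distrib, ← Finset.mul_sum, hδ, mul_one] at h1
  rw [Fin.sum_univ_castSucc]
  rwa [Finset.sum_subset (Finset.subset_univ _) fun i _ hi =>
    not_not.1 (mt mem_nonzeroIdx.2 hi)] at h1

theorem CondB.eq_zero (h : CondB σ) (i : Fin n) : σ i.castSucc = 0 := by
  by_contra hi
  have := mem_nonzeroIdx.2 hi
  simp [h.1] at this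

theorem CondB.sum_eq (h : CondB σ) : ∑ i, σ i = σ (Fin.last n) := by
  rw [Fin.sum_univ_castSucc]
  simp [h.eq_zero]

/-- After multiplication by `a + b`, the two sides differ by exactly `‖a • p + b • q‖ ^ 2`; neither
coefficient needs a sign. -/
theorem parallel_sum_le {H : Type*} [NormedAddCommGroup H] [InnerProductSpace ℝ H] {a b : ℝ}
    (hab : 0 < a + b) (p q : H) :
    a * b / (a + b) * ‖p - q‖ ^ 2 ≤ a * ‖p‖ ^ 2 + b * ‖q‖ ^ 2 := by
  rw [div_mul_eq_mul_div, div_le_iff₀ hab]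
  have h1 : 0 ≤ ‖a • p + b • q‖ ^ 2 := sq_nonneg _
  rw [norm_add_sq_real, real_inner_smul_left, real_inner_smul_right, norm_smul, norm_smul, mul_pow,
    mul_pow, Real.norm_eq_abs, Real.norm_eq_abs, sq_abs, sq_abs] at h1
  rw [norm_sub_sq_real]
  nlinarith

theorem CondB.admissible {H : Type*} [NormedAddCommGroup H] [InnerProductSpace ℝ H]
    (hμ2 : μ < 2) (hw : ∀ i, 0 < w i) (hlam : 0 < lam) (h : CondB σ) :
    Admissible H σ w lam μ where
  fst i := by simpa [h.eq_zero] using hw i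
  snd := by have := mul_nonneg hlam.le h.2; linarith
  conical := by
    refine ⟨1, by linarith, fun p q => ?_⟩
    have := mul_nonneg hlam.le (mul_nonneg h.2 (sq_nonneg ‖q‖))
    simpa [h.eq_zero] using this

theorem CondA.admissible {H : Type*} [NormedAddCommGroup H] [InnerProductSpace ℝ H]
    (hμ0 : 0 < μ) (hμ2 : μ < 2) (hw : ∀ i, 0 < w i) (hwsum : ∑ i, w i = 1) (hlam : 0 < lam)
    (h : CondA σ w lam μ) : Admissible H σ w lam μ := by
  obtain ⟨hne, δ, hpos, hδ, hκ⟩ := h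
  have hprod : ∀ i ∈ nonzeroIdx σ, 0 < w i * (σ i.castSucc + σ (Fin.last n) * δ i)
      + lam * (σ i.castSucc * (σ (Fin.last n) * δ i)) := by
    intro i hi
    have h1 := hpos i hi
    have h2 : 0 < 1 + lam / w i * ((σ i.castSucc * σ (Fin.last n) * δ i) /
      (σ i.castSucc + σ (Fin.last n) * δ i)) := by linarith [hκ i hi]
    have h3 := mul_pos h2 (mul_pos (hw i) h1)
    have hwi := (hw i).ne'
    have h1' := h1.ne'
    have e : w i * (σ i.castSucc + σ (Fin.last n) * δ i)
        + lam * (σ i.castSucc * (σ (Fin.last n) * δ i)) =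
        (1 + lam / w i * ((σ i.castSucc * σ (Fin.last n) * δ i) /
          (σ i.castSucc + σ (Fin.last n) * δ i))) *
            (w i * (σ i.castSucc + σ (Fin.last n) * δ i)) := by
      field_simp
    rw [e]
    exact h3
  -- If `u + lam * a ≤ 0`, then `a < 0 < b`, and `u * a + b * (u + lam * a)` would be negative,
  -- although it is the third hypothesis rearranged.
  have aux : ∀ {u a b : ℝ}, 0 < u → 0 < a + b → 0 < u * (a + b) + lam * (a * b) →
      0 < u + lam * a := by
    intro u a b hu hab h
    by_contra! hneg
    have ha : a < 0 := by
      by_contra! ha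
      have := mul_nonneg hlam.le ha
      linarith
    nlinarith
  refine ⟨fun i => ?_, ?_, ?_⟩
  · by_cases hi : i ∈ nonzeroIdx σ
    · exact aux (hw i) (hpos i hi) (hprod i hi)
    · rw [not_not.1 (mt mem_nonzeroIdx.2 hi)]
      simpa using hw i
  · have h1 : ∀ i ∈ nonzeroIdx σ, 0 < w i + lam * (σ (Fin.last n) * δ i) := fun i hi =>
      aux (b := σ i.castSucc) (hw i) (by linarith [hpos i hi]) (by linarith [hprod i hi])
    have h2 := Finset.sum_pos h1 hne
    rw [Finset.sum_add_distrib, ← Finset.mul_sum, ← Finset.mul_sum, hδ, mul_one] at h2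
    have h3 : ∑ i ∈ nonzeroIdx σ, w i ≤ 1 := by
      rw [← hwsum]
      exact Finset.sum_le_sum_of_subset_of_nonneg (Finset.subset_univ _) fun i _ _ => (hw i).le
    linarith
  -- Finitely many strict inequalities leave room for one `κ` above `μ / 2`. The bound `κ < 1`
  -- serves the indices with zero modulus.
  · have hev : ∀ᶠ κ in 𝓝[>] (μ / 2), κ < 1 ∧ ∀ i ∈ nonzeroIdx σ,
        κ < 1 + lam / w i * ((σ i.castSucc * σ (Fin.last n) * δ i) /
          (σ i.castSucc + σ (Fin.last n) * δ i)) := by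
      refine Filter.Eventually.and (nhdsWithin_le_nhds (eventually_lt_nhds (by linarith))) ?_
      rw [Filter.eventually_all_finset]
      exact fun i hi => nhdsWithin_le_nhds (eventually_lt_nhds (hκ i hi))
    obtain ⟨κ, ⟨hκ1, hκI⟩, hκμ⟩ := (hev.and self_mem_nhdsWithin).exists
    refine ⟨κ, hκμ, fun p q => ?_⟩
    have hσ : σ (Fin.last n) * ‖q‖ ^ 2 =
        ∑ i, if i ∈ nonzeroIdx σ then σ (Fin.last n) * δ i * ‖q‖ ^ 2 else 0 := by
      rw [Finset.sum_ite_mem, Finset.univ_inter, ← Finset.sum_mul, ← Finset.mul_sum, hδ, mul_one]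
    rw [hσ, ← Finset.sum_add_distrib, Finset.mul_sum, Finset.mul_sum]
    refine Finset.sum_le_sum fun i _ => ?_
    split_ifs with hi
    · have h1 := parallel_sum_le (hpos i hi) (p i) q
      have h2 := mul_lt_mul_of_pos_left (hκI i hi) (hw i)
      have h3 : w i * (1 + lam / w i * ((σ i.castSucc * σ (Fin.last n) * δ i) /
          (σ i.castSucc + σ (Fin.last n) * δ i))) = w i + lam * (σ i.castSucc *
          (σ (Fin.last n) * δ i) / (σ i.castSucc + σ (Fin.last n) * δ i)) := by
        have hwi := (hw i).ne'
        rw [mul_add, ← mul_assoc, mul_div_cancel₀ _ hwi, mul_one, mul_assoc (σ i.castSucc)]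
      rw [h3] at h2
      have h4 := mul_le_mul_of_nonneg_left h1 hlam.le
      have h5 := mul_le_mul_of_nonneg_right h2.le (sq_nonneg ‖p i - q‖)
      linarith
    · rw [not_not.1 (mt mem_nonzeroIdx.2 hi)]
      have := mul_nonneg (hw i).le (sq_nonneg ‖p i - q‖)
      nlinarith

end Conditions

/-! ### Fixed points and zeros -/

section FixedPoints

variable {H : Type*} [NormedAddCommGroup H] [InnerProductSpace ℝ H] {n : ℕ}
  {A : Fin (n + 1) → H → Set H} {σ : Fin (n + 1) → ℝ} {w : Fin n → ℝ} {lam μ : ℝ}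

theorem norm_diagEmb_sub_le {H : Type*} [NormedAddCommGroup H] (a a' : H) :
    ‖diagEmb n a - diagEmb n a'‖ ≤ n * ‖a - a'‖ := by
  have h : ‖diagEmb n a - diagEmb n a'‖ ^ 2 ≤ (n * ‖a - a'‖) ^ 2 := by
    rw [norm_sq_eq_sum]
    calc ∑ i, ‖(diagEmb n a - diagEmb n a') i‖ ^ 2 = n * ‖a - a'‖ ^ 2 := by simp
      _ ≤ (n : ℝ) ^ 2 * ‖a - a'‖ ^ 2 := by
          refine mul_le_mul_of_nonneg_right ?_ (sq_nonneg _)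
          exact_mod_cast Nat.le_self_pow two_ne_zero n
      _ = _ := by ring
  exact le_of_sq_le_sq h (by positivity)

theorem setResolvent_unique {E : Type*} [NormedAddCommGroup E] [InnerProductSpace ℝ E]
    {A : E → Set E} {s γ : ℝ} (hA : IsSigmaMonotone s A) (hγ : 0 < γ) (hs : 0 < 1 + γ * s)
    {x u v : E} (hu : u ∈ setResolvent γ A x) (hv : v ∈ setResolvent γ A x) : u = v := by
  rw [mem_setResolvent_iff hγ.ne'] at hu hv
  have h := hA.le_inner hu hv
  have e : γ⁻¹ • (x - u) - γ⁻¹ • (x - v) = -(γ⁻¹ • (u - v)) := by module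
  rw [e, inner_neg_right, real_inner_smul_right, real_inner_self_eq_norm_sq] at h
  have h2 := mul_le_mul_of_nonneg_left h hγ.le
  rw [mul_neg, mul_inv_cancel_left₀ hγ.ne'] at h2
  have h3 : ‖u - v‖ ^ 2 = 0 := by nlinarith [sq_nonneg ‖u - v‖]
  exact sub_eq_zero.1 (norm_eq_zero.1 (pow_eq_zero_iff two_ne_zero |>.1 h3))

/-- The selected operator values add up to a weighted mean of `z i - a`: they sum to zero at a fixed
point and asymptotically along the iteration. -/
theorem sum_step_residuals (hwsum : ∑ i, w i = 1) (x z : HPow H n) (a : H) :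
    ∑ i, (w i / lam) • (x i - z i) + lam⁻¹ • (∑ i, w i • ((2 : ℝ) • z i - x i) - a)
      = lam⁻¹ • ∑ i, w i • (z i - a) := by
  have h1 : ∑ i, (w i / lam) • (x i - z i) = lam⁻¹ • ∑ i, w i • (x i - z i) := by
    rw [Finset.smul_sum]
    exact Finset.sum_congr rfl fun i _ => by rw [smul_smul, div_eq_inv_mul]
  have h2 : a = ∑ i, w i • a := by rw [← Finset.sum_smul, hwsum, one_smul]
  rw [h1, ← smul_add]
  congr 1
  nth_rewrite 1 [h2]
  rw [← Finset.sum_sub_distrib, ← Finset.sum_add_distrib]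
  exact Finset.sum_congr rfl fun i _ => by module

theorem IsDRStep.mem_zer (hwsum : ∑ i, w i = 1) {x : HPow H n} {ζ : H}
    (h : IsDRStep A w lam x (diagEmb n ζ) ζ) : ζ ∈ zer (∑ i, A i) := by
  have h0 := sum_step_residuals (lam := lam) hwsum x (diagEmb n ζ) ζ
  simp only [diagEmb_apply, sub_self, smul_zero, Finset.sum_const_zero] at h0
  change (0 : H) ∈ (∑ i, A i) ζ
  rw [Finset.sum_apply, ← h0, Fin.sum_univ_castSucc]
  exact Set.add_mem_add (Set.finsetSum_mem_finsetSum _ _ _ fun i _ => h.1 i) h.2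

theorem exists_isDRStep_of_mem_zer (hw : ∀ i, 0 < w i) (hwsum : ∑ i, w i = 1) (hlam : 0 < lam)
    {ζ : H} (h : ζ ∈ zer (∑ i, A i)) : ∃ x, IsDRStep A w lam x (diagEmb n ζ) ζ := by
  change (0 : H) ∈ (∑ i, A i) ζ at h
  rw [Finset.sum_apply, Set.mem_fintype_sum] at h
  obtain ⟨u, hu, hsum⟩ := h
  rw [Fin.sum_univ_castSucc] at hsum
  -- Chosen so that the operator values selected by the step at `ζ` are exactly the given `u`.
  let x : HPow H n := WithLp.toLp 2 fun i => ζ + (lam / w i) • u i.castSucc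
  have hx : ∀ i : Fin n, (w i / lam) • (x i - diagEmb n ζ i) = u i.castSucc := fun i => by
    have e : x i - diagEmb n ζ i = (lam / w i) • u i.castSucc := add_sub_cancel_left _ _
    have hwi := (hw i).ne'
    rw [e, smul_smul, div_mul_div_cancel₀ hlam.ne', div_self hwi, one_smul]
  refine ⟨x, fun i => ?_, ?_⟩
  · rw [hx]
    exact hu _
  · have h0 := sum_step_residuals (lam := lam) hwsum x (diagEmb n ζ) ζ
    simp_rw [hx] at h0
    simp only [diagEmb_apply, sub_self, smul_zero, Finset.sum_const_zero] at h0
    rw [← hsum] at h0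
    simp only [diagEmb_apply]
    rw [add_left_cancel h0]
    exact hu _

theorem IsDRStep.mem_fixedPts (hn : 1 ≤ n) (hwsum : ∑ i, w i = 1) (hlam : 0 < lam)
    {x : HPow H n} {ζ : H} (h : IsDRStep A w lam x (diagEmb n ζ) ζ) :
    x ∈ fixedPts (drMap (diagOp w) lam μ (opF A) (opG w A)) := by
  obtain ⟨h1, h2⟩ := (mem_warpedResolvent_and_iff hn hwsum hlam.ne').2 ⟨ζ, rfl, h⟩
  exact ⟨_, h1, _, h2, by simp⟩

theorem warpedResolvent_opF_unique (hA : ∀ i, IsMaximalSigmaMonotone (σ i) (A i))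
    (hw : ∀ i, 0 < w i) (hlam : 0 < lam) (had : Admissible H σ w lam μ) {x z z' : HPow H n}
    (hz : z ∈ warpedResolvent (diagOp w) lam (opF A) x)
    (hz' : z' ∈ warpedResolvent (diagOp w) lam (opF A) x) : z = z' := by
  rw [mem_warpedResolvent_opF_iff hlam.ne'] at hz hz'
  ext i
  have hγ : 0 < lam / w i := div_pos hlam (hw i)
  have hs : 0 < 1 + lam / w i * σ i.castSucc := by
    have := div_pos (had.fst i) (hw i)
    rwa [add_div, div_self (hw i).ne', mul_div_right_comm] at this
  refine setResolvent_unique (hA i.castSucc).1 hγ hs (x := x i) ?_ ?_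
  · rw [mem_setResolvent_iff hγ.ne', inv_div]
    exact hz i
  · rw [mem_setResolvent_iff hγ.ne', inv_div]
    exact hz' i

theorem IsDRStep.idSub_drMap (hn : 1 ≤ n) (hA : ∀ i, IsMaximalSigmaMonotone (σ i) (A i))
    (hw : ∀ i, 0 < w i) (hwsum : ∑ i, w i = 1) (hlam : 0 < lam) (had : Admissible H σ w lam μ)
    {x z : HPow H n} {a : H} (h : IsDRStep A w lam x z a) :
    idSub (drMap (diagOp w) lam μ (opF A) (opG w A)) x = {μ • (z - diagEmb n a)} := by
  obtain ⟨L, -, hL⟩ := IsDRStep.lipschitz hA hlam hw hwsum had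
  ext r
  constructor
  · rintro ⟨_, ⟨z', hz', y', hy', rfl⟩, rfl⟩
    obtain ⟨a', rfl, h'⟩ := (mem_warpedResolvent_and_iff hn hwsum hlam.ne').1 ⟨hz', hy'⟩
    obtain ⟨e1, e2⟩ := hL h' h
    rw [sub_self, norm_zero, mul_zero, norm_le_zero_iff, sub_eq_zero] at e1 e2
    subst e1 e2
    rw [Set.mem_singleton_iff]
    module
  · rintro rfl
    obtain ⟨h1, h2⟩ := (mem_warpedResolvent_and_iff hn hwsum hlam.ne').2 ⟨a, rfl, h⟩
    exact ⟨_, ⟨z, h1, _, h2, rfl⟩, by module⟩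

theorem IsDRStep.opU_eq (hA : ∀ i, IsMaximalSigmaMonotone (σ i) (A i))
    (hw : ∀ i, 0 < w i) (hlam : 0 < lam) (had : Admissible H σ w lam μ)
    {x : HPow H n} {ζ : H} (h : IsDRStep A w lam x (diagEmb n ζ) ζ) :
    opU w lam A x = {ζ} := by
  have hR : ∀ i : Fin n, w i • reflectedResolvent (lam / w i) (A i.castSucc) (x i)
      = {w i • ((2 : ℝ) • ζ - x i)} := by
    intro i
    have hγ : 0 < lam / w i := div_pos hlam (hw i)
    have hs : 0 < 1 + lam / w i * σ i.castSucc := by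
      have := div_pos (had.fst i) (hw i)
      rwa [add_div, div_self (hw i).ne', mul_div_right_comm] at this
    have hmem : ζ ∈ setResolvent (lam / w i) (A i.castSucc) (x i) := by
      rw [mem_setResolvent_iff hγ.ne', inv_div]
      exact h.1 i
    rw [← Set.smul_set_singleton]
    congr 1
    ext r
    constructor
    · rintro ⟨b, hb, rfl⟩
      rw [setResolvent_unique (hA i.castSucc).1 hγ hs hb hmem, Set.mem_singleton_iff]
    · rintro rfl
      exact ⟨ζ, hmem, rfl⟩
  have hmem : ζ ∈ setResolvent lam (A (Fin.last n)) (∑ i, w i • ((2 : ℝ) • ζ - x i)) :=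
    (mem_setResolvent_iff hlam.ne').2 h.2
  ext u
  simp only [opU, hR, Set.finsetSum_singleton, Set.mem_ofPred_eq, Set.mem_singleton_iff,
    exists_eq_left]
  exact ⟨fun hu => setResolvent_unique (hA _).1 hlam had.snd hu hmem, fun hu => hu ▸ hmem⟩

/-- In `IsDRStep.basic`, replacing `z i` by `a + (z i - a)` collects all moduli in front of `‖a -
a'‖ ^ 2`. Every term on the right contains `z i - a`, so only the sum of the moduli has to be
positive. -/
theorem IsDRStep.strong (hA : ∀ i, IsMaximalSigmaMonotone (σ i) (A i)) (hlam : 0 < lam)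
    (hw : ∀ i, 0 < w i) (hwsum : ∑ i, w i = 1) {x z x' : HPow H n} {a a' : H}
    (h : IsDRStep A w lam x z a) (h' : IsDRStep A w lam x' (diagEmb n a') a') :
    lam * (∑ i, σ i) * ‖a - a'‖ ^ 2 ≤ ∑ i : Fin n, (w i * ⟪z i - a, x i - x' i⟫
      - lam * (σ i.castSucc * (2 * ⟪z i - a, a - a'⟫ + ‖z i - a‖ ^ 2))) := by
  have h1 := h.basic hA hlam hwsum h'
  have e : ∀ i, (z i - diagEmb n a' i) - (a - a') = z i - a := fun i => by
    rw [diagEmb_apply]; abel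
  have e2 : ∀ i, ‖z i - diagEmb n a' i‖ ^ 2
      = ‖a - a'‖ ^ 2 + (2 * ⟪z i - a, a - a'⟫ + ‖z i - a‖ ^ 2) := fun i => by
    have : z i - diagEmb n a' i = (z i - a) + (a - a') := by rw [diagEmb_apply]; abel
    rw [this, norm_add_sq_real]
    ring
  simp_rw [e, e2] at h1
  have h2 : 0 ≤ ∑ i, w i * ‖z i - a‖ ^ 2 :=
    Finset.sum_nonneg fun i _ => mul_nonneg (hw i).le (sq_nonneg _)
  rw [Finset.sum_sub_distrib, ← Finset.mul_sum, Fin.sum_univ_castSucc]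
  simp only [mul_add, Finset.sum_add_distrib, ← Finset.sum_mul] at h1 ⊢
  linarith

theorem zer_unique (hA : ∀ i, IsMaximalSigmaMonotone (σ i) (A i)) (hlam : 0 < lam)
    (hw : ∀ i, 0 < w i) (hwsum : ∑ i, w i = 1) (hσ : 0 < ∑ i, σ i) {ζ ζ' : H}
    (h : ζ ∈ zer (∑ i, A i)) (h' : ζ' ∈ zer (∑ i, A i)) : ζ = ζ' := by
  obtain ⟨x, hx⟩ := exists_isDRStep_of_mem_zer hw hwsum hlam h
  obtain ⟨x', hx'⟩ := exists_isDRStep_of_mem_zer hw hwsum hlam h'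
  have h1 := hx.strong hA hlam hw hwsum hx'
  simp only [diagEmb_apply, sub_self, inner_zero_left, norm_zero, mul_zero, ne_eq,
    OfNat.ofNat_ne_zero, not_false_eq_true, zero_pow, add_zero, Finset.sum_const_zero] at h1
  have h2 : ‖ζ - ζ'‖ ^ 2 ≤ 0 := nonpos_of_mul_nonpos_right h1 (mul_pos hlam hσ)
  exact sub_eq_zero.1 (norm_eq_zero.1
    (pow_eq_zero_iff two_ne_zero |>.1 (le_antisymm h2 (sq_nonneg _))))

end FixedPoints

/-! ### Weak cluster points -/

section Limits

variable {H : Type*} [NormedAddCommGroup H] [InnerProductSpace ℝ H] {n : ℕ}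
  {A : Fin (n + 1) → H → Set H} {σ : Fin (n + 1) → ℝ} {w : Fin n → ℝ} {lam μ : ℝ}
  {α : Type*} {x z : α → HPow H n} {a : α → H}

/-- Weak cluster points of Douglas-Rachford steps with vanishing residual are fixed points. -/
theorem exists_isDRStep_of_weakLim [CompleteSpace H]
    (hA : ∀ i, IsMaximalSigmaMonotone (σ i) (A i)) (hwsum : ∑ i, w i = 1)
    (U : Ultrafilter α) (hs : ∀ k, IsDRStep A w lam (x k) (z k) (a k)) {C : ℝ}
    (hxC : ∀ k, ‖x k‖ ≤ C) (hzC : ∀ k, ‖z k‖ ≤ C) (haC : ∀ k, ‖a k‖ ≤ C)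
    (hza : ∀ i, Tendsto (fun k => z k i - a k) U (𝓝 0))
    (hσ : (∀ i, σ i = 0) ∨ ∃ ζ, Tendsto a U (𝓝 ζ))
    {xb : HPow H n} (hxb : WeakLim U x xb) :
    ∃ ζ, IsDRStep A w lam xb (diagEmb n ζ) ζ ∧ WeakLim U a ζ := by
  obtain ⟨ζ, hζ⟩ := exists_weakLim_of_bounded U haC
  have hstrong : (∀ i, σ i = 0) ∨ Tendsto a U (𝓝 ζ) := hσ.imp_right fun ⟨ζ', h⟩ => by
    rwa [hζ.unique (WeakLim.of_tendsto h)]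
  have hzw : ∀ i, WeakLim U (fun k => z k i) ζ := fun i => by
    simpa using (WeakLim.of_tendsto (hza i)).add hζ
  have hxw := weakLim_pi_iff.1 hxb
  -- All `n + 1` operators form one family, with `a` in the last slot, so that demiclosedness
  -- applies to them jointly.
  let Z : Fin (n + 1) → α → H := Fin.lastCases a fun i k => z k i
  let u : Fin (n + 1) → α → H := Fin.lastCases
    (fun k => lam⁻¹ • (∑ i, w i • ((2 : ℝ) • z k i - x k i) - a k))
    fun i k => (w i / lam) • (x k i - z k i)
  let ub : Fin (n + 1) → H := Fin.lastCases
    (lam⁻¹ • (∑ i, w i • ((2 : ℝ) • diagEmb n ζ i - xb i) - ζ))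
    fun i => (w i / lam) • (xb i - diagEmb n ζ i)
  have hZc : ∀ i : Fin n, Z i.castSucc = fun k => z k i := fun i => Fin.lastCases_castSucc i
  have hZl : Z (Fin.last n) = a := Fin.lastCases_last
  have huc : ∀ i : Fin n, u i.castSucc = fun k => (w i / lam) • (x k i - z k i) :=
    fun i => Fin.lastCases_castSucc i
  have hul : u (Fin.last n) = fun k => lam⁻¹ • (∑ i, w i • ((2 : ℝ) • z k i - x k i) - a k) :=
    Fin.lastCases_last
  have hubc : ∀ i : Fin n, ub i.castSucc = (w i / lam) • (xb i - diagEmb n ζ i) :=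
    fun i => Fin.lastCases_castSucc i
  have hubl : ub (Fin.last n) = lam⁻¹ • (∑ i, w i • ((2 : ℝ) • diagEmb n ζ i - xb i) - ζ) :=
    Fin.lastCases_last
  have hZa : ∀ i, Tendsto (fun k => Z i k - a k) U (𝓝 0) := by
    refine Fin.lastCases ?_ fun i => ?_
    · simp [hZl]
    · rw [hZc]
      exact hza i
  have key := mem_of_weakLim hA (l := (U : Filter α)) (z := Z) (u := u) (a := a) (ζ := ζ)
    (ub := ub) (C := C) ?_ ?_ ?_ hZa ?_ haC ?_ ?_
  · refine ⟨ζ, ⟨fun i => ?_, ?_⟩, hζ⟩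
    · rw [← hubc]
      exact key.2 _
    · rw [← hubl]
      exact key.2 _
  · refine Fin.lastCases (fun k => ?_) fun i k => ?_
    · rw [hul, hZl]
      exact (hs k).2
    · rw [huc, hZc]
      exact (hs k).1 i
  · refine Fin.lastCases ?_ fun i => ?_
    · rwa [hZl]
    · rw [hZc]
      exact hzw i
  · refine Fin.lastCases ?_ fun i => ?_
    · rw [hul, hubl]
      exact ((WeakLim.sum Finset.univ fun i =>
        (((hzw i).const_smul 2).sub (hxw i)).const_smul (w i)).sub hζ).const_smul _
    · rw [huc, hubc]
      exact ((hxw i).sub (hzw i)).const_smul _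
  · have h1 : Tendsto (fun k => lam⁻¹ • ∑ i, w i • (z k i - a k)) U
        (𝓝 (lam⁻¹ • ∑ i : Fin n, w i • (0 : H))) :=
      (tendsto_finsetSum _ fun i _ => (hza i).const_smul (w i)).const_smul _
    simp only [smul_zero, Finset.sum_const_zero] at h1
    refine h1.congr fun k => ?_
    rw [← sum_step_residuals hwsum (x k), Fin.sum_univ_castSucc, hul]
    simp_rw [huc]
  · have hO : ∀ {f : α → H} {D : ℝ}, (∀ k, ‖f k‖ ≤ D) → f =O[⊤] (fun _ => (1 : ℝ)) :=
      fun {f D} h => isBigO_top.2 ⟨D, fun k => by simpa using h k⟩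
    have hx1 : ∀ i, (fun k => x k i) =O[⊤] (fun _ => (1 : ℝ)) := fun i =>
      hO fun k => (norm_apply_le (x k) i).trans (hxC k)
    have hz1 : ∀ i, (fun k => z k i) =O[⊤] (fun _ => (1 : ℝ)) := fun i =>
      hO fun k => (norm_apply_le (z k) i).trans (hzC k)
    have hu1 : ∀ i, u i =O[⊤] (fun _ => (1 : ℝ)) := by
      refine Fin.lastCases ?_ fun i => ?_
      · rw [hul]
        exact ((IsBigO.fun_sum fun i _ => (((hz1 i).const_smul_left 2).sub
          (hx1 i)).const_smul_left (w i)).sub (hO haC)).const_smul_left _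
      · rw [huc]
        exact ((hx1 i).sub (hz1 i)).const_smul_left _
    intro i
    obtain ⟨D, hD⟩ := isBigO_top.1 (hu1 i)
    exact ⟨D, fun k => by simpa using hD k⟩
  -- The squared norm is not weakly continuous, so these terms converge either because the moduli
  -- vanish or because `a` converges strongly.
  · intro i p
    rcases hstrong with h0 | h
    · simp [h0]
    · have h1 : Tendsto (Z i) U (𝓝 ζ) := by simpa using (hZa i).add h
      exact ((h1.sub_const p).norm.pow 2).const_mul _

/-- Opial's argument: weak cluster points at which the distance converges coincide. -/
theorem eq_of_weakLim_of_tendsto_wsq (hw : ∀ i, 0 < w i) {l l₁ l₂ : Filter α} [l₁.NeBot]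
    [l₂.NeBot] (h₁ : l₁ ≤ l) (h₂ : l₂ ≤ l) {p q : HPow H n} {c d : ℝ}
    (hp : Tendsto (fun k => wsq w (x k - p)) l (𝓝 c))
    (hq : Tendsto (fun k => wsq w (x k - q)) l (𝓝 d))
    (hlp : WeakLim l₁ x p) (hlq : WeakLim l₂ x q) : p = q := by
  -- The quadratic terms in `x k` cancel, so the difference is affine in `x k` and passes to weak
  -- limits.
  have e : ∀ k, wsq w (x k - p) - wsq w (x k - q)
      = 2 * ∑ i, w i * ⟪x k i, q i - p i⟫ + (wsq w p - wsq w q) := by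
    intro k
    simp only [wsq, Finset.mul_sum, ← Finset.sum_sub_distrib, ← Finset.sum_add_distrib]
    refine Finset.sum_congr rfl fun i _ => ?_
    rw [PiLp.sub_apply, PiLp.sub_apply, norm_sub_sq_real, norm_sub_sq_real, inner_sub_right]
    ring
  have hlim := hp.sub hq
  simp_rw [e] at hlim
  have hl : ∀ {l' : Filter α} {b : HPow H n}, WeakLim l' x b →
      Tendsto (fun k => 2 * ∑ i, w i * ⟪x k i, q i - p i⟫ + (wsq w p - wsq w q)) l'
        (𝓝 (2 * ∑ i, w i * ⟪b i, q i - p i⟫ + (wsq w p - wsq w q))) := fun hb =>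
    ((tendsto_finsetSum _ fun i _ =>
      (weakLim_pi_iff.1 hb i _).const_mul (w i)).const_mul 2).add_const _
  have h3 := tendsto_nhds_unique (hl hlp) (hlim.mono_left h₁)
  have h4 := tendsto_nhds_unique (hl hlq) (hlim.mono_left h₂)
  have h5 : wsq w (q - p) = 0 := by
    have : wsq w (q - p) = ∑ i, w i * ⟪q i, q i - p i⟫ - ∑ i, w i * ⟪p i, q i - p i⟫ := by
      rw [← Finset.sum_sub_distrib]
      refine Finset.sum_congr rfl fun i _ => ?_
      rw [← mul_sub, ← inner_sub_left, real_inner_self_eq_norm_sq, PiLp.sub_apply]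
    rw [this]
    linarith
  have h6 := norm_sq_le_wsq hw (q - p)
  rw [h5, mul_zero] at h6
  exact (sub_eq_zero.1 (norm_eq_zero.1
    (pow_eq_zero_iff two_ne_zero |>.1 (le_antisymm h6 (sq_nonneg _))))).symm

end Limits

/-! ### Convergence of the iteration -/

section Sequence

variable {H : Type*} [NormedAddCommGroup H] [InnerProductSpace ℝ H] {n : ℕ}
  {A : Fin (n + 1) → H → Set H} {σ : Fin (n + 1) → ℝ} {w : Fin n → ℝ} {lam μ : ℝ}
  {x z : ℕ → HPow H n} {a : ℕ → H}

theorem antitone_wsq_sub (hA : ∀ i, IsMaximalSigmaMonotone (σ i) (A i)) (hlam : 0 < lam)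
    (hw : ∀ i, 0 < w i) (hwsum : ∑ i, w i = 1) (hμ : 0 < μ) (had : Admissible H σ w lam μ)
    (hs : ∀ k, IsDRStep A w lam (x k) (z k) (a k))
    (hx : ∀ k, x (k + 1) = x k + μ • (diagEmb n (a k) - z k))
    {p : HPow H n} {ζ : H} (hp : IsDRStep A w lam p (diagEmb n ζ) ζ) :
    Antitone fun k => wsq w (x k - p) := by
  obtain ⟨c, hc, h⟩ := IsDRStep.fejer hA hlam hwsum hμ had
  refine antitone_nat_of_succ_le fun k => ?_
  have h1 := h (hs k) hp
  rw [sub_self, smul_zero, add_zero, ← hx] at h1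
  have := mul_nonneg hc.le (wsq_nonneg hw (z k - diagEmb n (a k) - 0))
  linarith

theorem summable_wsq_residual (hA : ∀ i, IsMaximalSigmaMonotone (σ i) (A i)) (hlam : 0 < lam)
    (hw : ∀ i, 0 < w i) (hwsum : ∑ i, w i = 1) (hμ : 0 < μ) (had : Admissible H σ w lam μ)
    (hs : ∀ k, IsDRStep A w lam (x k) (z k) (a k))
    (hx : ∀ k, x (k + 1) = x k + μ • (diagEmb n (a k) - z k))
    {p : HPow H n} {ζ : H} (hp : IsDRStep A w lam p (diagEmb n ζ) ζ) :
    Summable fun k => wsq w (z k - diagEmb n (a k)) := by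
  obtain ⟨c, hc, h⟩ := IsDRStep.fejer hA hlam hwsum hμ had
  refine summable_of_sum_range_le (c := wsq w (x 0 - p) / c) (fun k => wsq_nonneg hw _)
    fun N => ?_
  rw [le_div_iff₀ hc, Finset.sum_mul]
  calc _ ≤ ∑ k ∈ Finset.range N, (wsq w (x k - p) - wsq w (x (k + 1) - p)) := by
        refine Finset.sum_le_sum fun k _ => ?_
        have h1 := h (hs k) hp
        rw [sub_self, smul_zero, add_zero, ← hx, sub_zero] at h1
        linarith
    _ = wsq w (x 0 - p) - wsq w (x N - p) := Finset.sum_range_sub' _ _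
    _ ≤ _ := sub_le_self _ (wsq_nonneg hw _)

theorem wsq_sub_succ (hx : ∀ k, x (k + 1) = x k + μ • (diagEmb n (a k) - z k)) (k : ℕ) :
    wsq w (x (k + 1) - x k) = μ ^ 2 * wsq w (z k - diagEmb n (a k)) := by
  have : x (k + 1) - x k = (-μ) • (z k - diagEmb n (a k)) := by rw [hx]; module
  rw [this, wsq_smul, neg_sq]

/-- The residual is the increment of `x` up to the factor `-μ`, and the Fejér estimate for two
consecutive steps says that increments do not grow. -/
theorem antitone_wsq_residual (hA : ∀ i, IsMaximalSigmaMonotone (σ i) (A i)) (hlam : 0 < lam)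
    (hw : ∀ i, 0 < w i) (hwsum : ∑ i, w i = 1) (hμ : 0 < μ) (had : Admissible H σ w lam μ)
    (hs : ∀ k, IsDRStep A w lam (x k) (z k) (a k))
    (hx : ∀ k, x (k + 1) = x k + μ • (diagEmb n (a k) - z k)) :
    Antitone fun k => wsq w (z k - diagEmb n (a k)) := by
  obtain ⟨c, hc, h⟩ := IsDRStep.fejer hA hlam hwsum hμ had
  refine antitone_nat_of_succ_le fun k => ?_
  have h1 := h (hs (k + 1)) (hs k)
  rw [← hx, ← hx, wsq_sub_succ hx, wsq_sub_succ hx] at h1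
  have := mul_nonneg hc.le (wsq_nonneg hw
    (z (k + 1) - diagEmb n (a (k + 1)) - (z k - diagEmb n (a k))))
  exact le_of_mul_le_mul_left (by linarith) (pow_pos hμ 2)

theorem tendsto_residual {H : Type*} [NormedAddCommGroup H] {z : ℕ → HPow H n} {a : ℕ → H}
    (hw : ∀ i, 0 < w i)
    (hsum : Summable fun k => wsq w (z k - diagEmb n (a k))) :
    Tendsto (fun k => z k - diagEmb n (a k)) atTop (𝓝 0) := by
  have h1 := hsum.tendsto_atTop_zero.const_mul (∑ i, (w i)⁻¹)
  rw [mul_zero] at h1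
  have h2 := (squeeze_zero (fun k => sq_nonneg _)
    (fun k => norm_sq_le_wsq hw (z k - diagEmb n (a k))) h1).sqrt
  simp only [Real.sqrt_sq (norm_nonneg _), Real.sqrt_zero] at h2
  exact tendsto_zero_iff_norm_tendsto_zero.2 h2

theorem tendsto_residual_apply {H : Type*} [NormedAddCommGroup H] {z : ℕ → HPow H n} {a : ℕ → H}
    (h : Tendsto (fun k => z k - diagEmb n (a k)) atTop (𝓝 0))
    (i : Fin n) : Tendsto (fun k => z k i - a k) atTop (𝓝 0) := by
  rw [tendsto_zero_iff_norm_tendsto_zero] at h ⊢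
  exact squeeze_zero (fun k => norm_nonneg _)
    (fun k => norm_apply_le (z k - diagEmb n (a k)) i) h

theorem exists_norm_le (hA : ∀ i, IsMaximalSigmaMonotone (σ i) (A i)) (hlam : 0 < lam)
    (hw : ∀ i, 0 < w i) (hwsum : ∑ i, w i = 1) (hμ : 0 < μ) (had : Admissible H σ w lam μ)
    (hs : ∀ k, IsDRStep A w lam (x k) (z k) (a k))
    (hx : ∀ k, x (k + 1) = x k + μ • (diagEmb n (a k) - z k))
    {p : HPow H n} {ζ : H} (hp : IsDRStep A w lam p (diagEmb n ζ) ζ) :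
    ∃ C, ∀ k, ‖x k‖ ≤ C ∧ ‖z k‖ ≤ C ∧ ‖a k‖ ≤ C := by
  obtain ⟨L, hL0, hL⟩ := IsDRStep.lipschitz hA hlam hw hwsum had
  have hanti := antitone_wsq_sub hA hlam hw hwsum hμ had hs hx hp
  set D := √((∑ i, (w i)⁻¹) * wsq w (x 0 - p)) with hD
  have hxD : ∀ k, ‖x k - p‖ ≤ D := fun k => Real.le_sqrt_of_sq_le
    ((norm_sq_le_wsq hw _).trans (mul_le_mul_of_nonneg_left (hanti (Nat.zero_le k))
      (Finset.sum_nonneg fun i _ => inv_nonneg.2 (hw i).le)))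
  refine ⟨max (D + ‖p‖) (max (L * D + ‖diagEmb n ζ‖) (L * D + ‖ζ‖)), fun k => ?_⟩
  have h1 := hxD k
  have h2 := mul_le_mul_of_nonneg_left h1 hL0
  obtain ⟨h3, h4⟩ := hL (hs k) hp
  refine ⟨le_max_of_le_left ?_, le_max_of_le_right (le_max_of_le_left ?_),
    le_max_of_le_right (le_max_of_le_right ?_)⟩
  · linarith [norm_sub_norm_le (x k) p]
  · linarith [norm_sub_norm_le (z k) (diagEmb n ζ)]
  · linarith [norm_sub_norm_le (a k) ζ]

theorem tendsto_of_sum_pos (hA : ∀ i, IsMaximalSigmaMonotone (σ i) (A i)) (hlam : 0 < lam)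
    (hw : ∀ i, 0 < w i) (hwsum : ∑ i, w i = 1) (hσ : 0 < ∑ i, σ i)
    (hs : ∀ k, IsDRStep A w lam (x k) (z k) (a k)) {C : ℝ}
    (hC : ∀ k, ‖x k‖ ≤ C ∧ ‖z k‖ ≤ C ∧ ‖a k‖ ≤ C)
    (hza : ∀ i, Tendsto (fun k => z k i - a k) atTop (𝓝 0))
    {p : HPow H n} {ζ : H} (hp : IsDRStep A w lam p (diagEmb n ζ) ζ) :
    Tendsto a atTop (𝓝 ζ) := by
  have hS : 0 < lam * ∑ i, σ i := mul_pos hlam hσ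
  have h1 : ∀ i, Tendsto (fun k => ⟪z k i - a k, x k i - p i⟫) atTop (𝓝 0) := fun i =>
    tendsto_inner_zero_of_bounded (C := C + ‖p‖) (hza i) fun k =>
      (norm_sub_le _ _).trans (add_le_add ((norm_apply_le _ i).trans (hC k).1) (norm_apply_le _ i))
  have h2 : ∀ i, Tendsto (fun k => ⟪z k i - a k, a k - ζ⟫) atTop (𝓝 0) := fun i =>
    tendsto_inner_zero_of_bounded (C := C + ‖ζ‖) (hza i) fun k =>
      (norm_sub_le _ _).trans (add_le_add (hC k).2.2 le_rfl)
  have h3 : Tendsto (fun k => (lam * ∑ i, σ i)⁻¹ *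
      ∑ i : Fin n, (w i * ⟪z k i - a k, x k i - p i⟫
      - lam * (σ i.castSucc * (2 * ⟪z k i - a k, a k - ζ⟫ + ‖z k i - a k‖ ^ 2)))) atTop
      (𝓝 ((lam * ∑ i, σ i)⁻¹ * ∑ i : Fin n, (w i * 0
        - lam * (σ i.castSucc * (2 * 0 + ‖(0 : H)‖ ^ 2))))) :=
    (tendsto_finsetSum _ fun i _ => ((h1 i).const_mul _).sub
      ((((h2 i).const_mul 2).add ((hza i).norm.pow 2)).const_mul _ |>.const_mul _)).const_mul _
  have h4 : Tendsto (fun k => ‖a k - ζ‖ ^ 2) atTop (𝓝 0) := by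
    simp only [mul_zero, norm_zero, ne_eq, OfNat.ofNat_ne_zero, not_false_eq_true, zero_pow,
      add_zero, sub_self, Finset.sum_const_zero] at h3
    refine squeeze_zero (fun k => sq_nonneg _) (fun k => ?_) h3
    rw [le_inv_mul_iff₀ hS]
    exact (hs k).strong hA hlam hw hwsum hp
  have h5 := h4.sqrt
  simp only [Real.sqrt_sq (norm_nonneg _), Real.sqrt_zero] at h5
  exact tendsto_iff_norm_sub_tendsto_zero.2 h5

theorem exists_weakLim [CompleteSpace H] (hA : ∀ i, IsMaximalSigmaMonotone (σ i) (A i))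
    (hlam : 0 < lam) (hw : ∀ i, 0 < w i) (hwsum : ∑ i, w i = 1) (hμ : 0 < μ)
    (had : Admissible H σ w lam μ)
    (hs : ∀ k, IsDRStep A w lam (x k) (z k) (a k))
    (hx : ∀ k, x (k + 1) = x k + μ • (diagEmb n (a k) - z k)) {C : ℝ}
    (hC : ∀ k, ‖x k‖ ≤ C ∧ ‖z k‖ ≤ C ∧ ‖a k‖ ≤ C)
    (hza : ∀ i, Tendsto (fun k => z k i - a k) atTop (𝓝 0))
    (hσ : (∀ i, σ i = 0) ∨ ∃ ζ, Tendsto a atTop (𝓝 ζ)) :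
    ∃ p ζ, IsDRStep A w lam p (diagEmb n ζ) ζ ∧ WeakLim atTop x p ∧ WeakLim atTop a ζ := by
  obtain ⟨L, -, hL⟩ := IsDRStep.lipschitz hA hlam hw hwsum had
  have hcl : ∀ U : Ultrafilter ℕ, (U : Filter ℕ) ≤ atTop → ∃ p ζ,
      IsDRStep A w lam p (diagEmb n ζ) ζ ∧ WeakLim U x p ∧ WeakLim U a ζ := by
    intro U hU
    obtain ⟨p, hp⟩ := exists_weakLim_of_bounded U fun k => (hC k).1
    obtain ⟨ζ, h1, h2⟩ := exists_isDRStep_of_weakLim hA hwsum U hs (fun k => (hC k).1)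
      (fun k => (hC k).2.1) (fun k => (hC k).2.2) (fun i => (hza i).mono_left hU)
      (hσ.imp_right fun ⟨ζ, h⟩ => ⟨ζ, h.mono_left hU⟩) hp
    exact ⟨p, ζ, h1, hp, h2⟩
  obtain ⟨p, ζ, hp, hxp, -⟩ := hcl (Ultrafilter.of atTop) (Ultrafilter.of_le _)
  have hlim : ∀ {q : HPow H n} {ξ : H}, IsDRStep A w lam q (diagEmb n ξ) ξ →
      ∃ c, Tendsto (fun k => wsq w (x k - q)) atTop (𝓝 c) := fun hq =>
    ⟨_, tendsto_atTop_ciInf (antitone_wsq_sub hA hlam hw hwsum hμ had hs hx hq)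
      ⟨0, Set.forall_mem_range.2 fun k => wsq_nonneg hw _⟩⟩
  -- Opial identifies the limit of `x` along `U` with `p`; uniqueness of the step at `p` then
  -- identifies the limit of `a` with `ζ`.
  have key : ∀ U : Ultrafilter ℕ, (U : Filter ℕ) ≤ atTop → WeakLim U x p ∧ WeakLim U a ζ := by
    intro U hU
    obtain ⟨q, ξ, hq, hxq, haq⟩ := hcl U hU
    obtain ⟨c, hc⟩ := hlim hp
    obtain ⟨d, hd⟩ := hlim hq
    have e := eq_of_weakLim_of_tendsto_wsq hw (Ultrafilter.of_le _) hU hc hd hxp hxq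
    subst e
    have e2 := (hL hp hq).2
    rw [sub_self, norm_zero, mul_zero, norm_le_zero_iff, sub_eq_zero] at e2
    subst e2
    exact ⟨hxq, haq⟩
  exact ⟨p, ζ, hp, weakLim_iff_ultrafilter.2 fun U hU => (key U hU).1,
    weakLim_iff_ultrafilter.2 fun U hU => (key U hU).2⟩

end Sequence

end DouglasRachford

/-! ### The main theorem -/

open DouglasRachford
theorem mainTheorem2 {H : Type*} [NormedAddCommGroup H] [InnerProductSpace ℝ H] [CompleteSpace H]
    {n : ℕ} (hn : 1 ≤ n)
    (A : Fin (n + 1) → H → Set H) (σ : Fin (n + 1) → ℝ)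
    (hA : ∀ i, IsMaximalSigmaMonotone (σ i) (A i))
    (hzer : (zer (∑ i, A i)).Nonempty)
    (μ : ℝ) (hμ0 : 0 < μ) (hμ2 : μ < 2)
    (w : Fin n → ℝ) (hw : ∀ i, 0 < w i) (hwsum : ∑ i, w i = 1)
    (lam : ℝ) (hlam : 0 < lam)
    (hAB : CondA σ w lam μ ∨ CondB σ)
    (x z y : ℕ → HPow H n)
    (hDR : IsDRSequence (diagOp w) lam μ (opF A) (opG w A) x z y) :
    ∃ xbar ∈ fixedPts (drMap (diagOp w) lam μ (opF A) (opG w A)), ∃ zbar : HPow H n,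
      -- (i)
      (Bornology.IsBounded (Set.range x) ∧ WeaklyTendsto x xbar ∧
        warpedResolvent (diagOp w) lam (opF A) xbar = {zbar} ∧
        zbar ∈ diagEmb n '' zer (∑ i, A i)) ∧
      -- (ii)
      (∃ r : ℕ → HPow H n,
        (∀ k, idSub (drMap (diagOp w) lam μ (opF A) (opG w A)) (x k) = {r k}) ∧
        (fun k => ‖r k‖) =o[atTop] (fun k : ℕ => 1 / √(k : ℝ))) ∧
      -- (iii)
      ((fun k => ‖y (k + 1) - y k‖) =o[atTop] (fun k : ℕ => 1 / √(k : ℝ)) ∧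
        (fun k => ‖z (k + 1) - z k‖) =o[atTop] (fun k : ℕ => 1 / √(k : ℝ)) ∧
        Bornology.IsBounded (Set.range z) ∧ Bornology.IsBounded (Set.range y)) ∧
      -- (iv)
      (CondA σ w lam μ ∨ (CondB σ ∧ 0 < σ (Fin.last n)) →
        Tendsto z atTop (𝓝 zbar) ∧ Tendsto y atTop (𝓝 zbar) ∧
        ∃ u : H, opU w lam A xbar = {u} ∧ zer (∑ i, A i) = {u}) ∧
      -- (v)
      (CondB σ ∧ σ (Fin.last n) = 0 → WeaklyTendsto z zbar ∧ WeaklyTendsto y zbar) := by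
  have had : Admissible H σ w lam μ := hAB.elim
    (fun h => h.admissible hμ0 hμ2 hw hwsum hlam) (fun h => h.admissible hμ2 hw hlam)
  have hstep := fun k =>
    (mem_warpedResolvent_and_iff hn hwsum hlam.ne').1 ⟨(hDR k).1, (hDR k).2.1⟩
  choose a hy hs using hstep
  have hx : ∀ k, x (k + 1) = x k + μ • (diagEmb n (a k) - z k) := fun k => by
    rw [← hy]
    exact (hDR k).2.2
  obtain ⟨ζ₀, hζ₀⟩ := hzer
  obtain ⟨p₀, hp₀⟩ := exists_isDRStep_of_mem_zer hw hwsum hlam hζ₀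
  obtain ⟨C, hC⟩ := exists_norm_le hA hlam hw hwsum hμ0 had hs hx hp₀
  have hsum := summable_wsq_residual hA hlam hw hwsum hμ0 had hs hx hp₀
  have hanti := antitone_wsq_residual hA hlam hw hwsum hμ0 had hs hx
  have hres := tendsto_residual hw hsum
  have hza := tendsto_residual_apply hres
  have hσpos : CondA σ w lam μ ∨ (CondB σ ∧ 0 < σ (Fin.last n)) → 0 < ∑ i, σ i := fun h =>
    h.elim (fun h => h.sum_pos) fun h => h.1.sum_eq ▸ h.2
  -- The dichotomy behind weak versus strong convergence: only (B) with zero last modulus falls in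
  -- the first case.
  have hcases : (∀ i, σ i = 0) ∨ 0 < ∑ i, σ i := by
    rcases hAB with h | h
    · exact Or.inr h.sum_pos
    · rcases h.2.eq_or_lt with h0 | h0
      · exact Or.inl (Fin.lastCases h0.symm h.eq_zero)
      · exact Or.inr (hσpos (Or.inr ⟨h, h0⟩))
  have hstrong : ∀ {q ζ}, 0 < ∑ i, σ i → IsDRStep A w lam q (diagEmb n ζ) ζ →
      Tendsto a atTop (𝓝 ζ) := fun h hq =>
    tendsto_of_sum_pos hA hlam hw hwsum h hs hC hza hq
  obtain ⟨xb, ζ, hxb, hxw, haw⟩ := exists_weakLim hA hlam hw hwsum hμ0 had hs hx hC hza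
    (hcases.imp_right fun h => ⟨ζ₀, hstrong h hp₀⟩)
  obtain ⟨L, hL0, hL⟩ := IsDRStep.lipschitz hA hlam hw hwsum had
  have hζ : ζ ∈ zer (∑ i, A i) := hxb.mem_zer hwsum
  have hzb := ((mem_warpedResolvent_and_iff hn hwsum hlam.ne').2 ⟨ζ, rfl, hxb⟩).1
  set W := ∑ i, (w i)⁻¹
  have hb0 : ∀ k, 0 ≤ wsq w (z k - diagEmb n (a k)) := fun k => wsq_nonneg hw _
  have hdx : ∀ k, ‖x (k + 1) - x k‖ ^ 2 ≤ W * (μ ^ 2 * wsq w (z k - diagEmb n (a k))) :=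
    fun k => by
      rw [← wsq_sub_succ hx]
      exact norm_sq_le_wsq hw _
  -- All three rates reduce to the increments of `x`, through equality or the Lipschitz bound.
  have hlittle : ∀ {f : ℕ → ℝ} {D : ℝ}, (∀ k, 0 ≤ f k) →
      (∀ k, f k ≤ D * ‖x (k + 1) - x k‖) → f =o[atTop] (fun k : ℕ => 1 / √(k : ℝ)) := by
    intro f D hf0 hf
    refine isLittleO_one_div_sqrt_of_sq_le (C := D ^ 2 * (W * μ ^ 2)) hb0 hanti hsum fun k => ?_
    calc f k ^ 2 ≤ (D * ‖x (k + 1) - x k‖) ^ 2 := pow_le_pow_left₀ (hf0 k) (hf k) 2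
      _ = D ^ 2 * ‖x (k + 1) - x k‖ ^ 2 := by ring
      _ ≤ D ^ 2 * (W * (μ ^ 2 * wsq w (z k - diagEmb n (a k)))) :=
          mul_le_mul_of_nonneg_left (hdx k) (sq_nonneg _)
      _ = _ := by ring
  have hbdd : ∀ {f : ℕ → HPow H n} {D : ℝ}, (∀ k, ‖f k‖ ≤ D) →
      Bornology.IsBounded (Set.range f) := fun {f D} h =>
    isBounded_iff_forall_norm_le.2 ⟨D, Set.forall_mem_range.2 h⟩
  have hzdiag : ∀ k, z k = (z k - diagEmb n (a k)) + y k := fun k => by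
    rw [hy, sub_add_cancel]
  refine ⟨xb, hxb.mem_fixedPts hn hwsum hlam, diagEmb n ζ,
    ⟨hbdd fun k => (hC k).1, weaklyTendsto_iff_weakLim.2 hxw, ?_, ζ, hζ, rfl⟩,
    ⟨fun k => μ • (z k - diagEmb n (a k)),
      fun k => (hs k).idSub_drMap hn hA hw hwsum hlam had, ?_⟩,
    ⟨?_, ?_, hbdd fun k => (hC k).2.1, ?_⟩, fun h => ?_, fun _ => ?_⟩
  · exact Set.eq_singleton_iff_unique_mem.2
      ⟨hzb, fun z' hz' => warpedResolvent_opF_unique hA hw hlam had hz' hzb⟩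
  · refine hlittle (D := 1) (fun k => norm_nonneg _) fun k => ?_
    have : x (k + 1) - x k = -(μ • (z k - diagEmb n (a k))) := by rw [hx]; module
    rw [this, norm_neg, one_mul]
  · refine hlittle (D := n * L) (fun k => norm_nonneg _) fun k => ?_
    rw [hy, hy, mul_assoc]
    exact (norm_diagEmb_sub_le _ _).trans
      (mul_le_mul_of_nonneg_left (hL (hs (k + 1)) (hs k)).2 (Nat.cast_nonneg n))
  · exact hlittle (fun k => norm_nonneg _) fun k => (hL (hs (k + 1)) (hs k)).1
  · refine hbdd (D := n * C) fun k => ?_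
    have h1 := norm_diagEmb_sub_le (n := n) (a k) 0
    have h2 : diagEmb n (0 : H) = 0 := rfl
    rw [h2, sub_zero, sub_zero, ← hy] at h1
    exact h1.trans (mul_le_mul_of_nonneg_left (hC k).2.2 (Nat.cast_nonneg n))
  · have hpos := hσpos h
    have hy' : Tendsto y atTop (𝓝 (diagEmb n ζ)) := by
      have h1 := (tendsto_iff_norm_sub_tendsto_zero.1 (hstrong hpos hxb)).const_mul (n : ℝ)
      rw [mul_zero] at h1
      refine tendsto_iff_norm_sub_tendsto_zero.2
        (squeeze_zero (fun k => norm_nonneg _) (fun k => ?_) h1)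
      rw [hy]
      exact norm_diagEmb_sub_le _ _
    refine ⟨?_, hy', ζ, hxb.opU_eq hA hw hlam had, Set.eq_singleton_iff_unique_mem.2
      ⟨hζ, fun ξ hξ => zer_unique hA hlam hw hwsum hpos hξ hζ⟩⟩
    have h1 := hres.add hy'
    rw [zero_add] at h1
    exact h1.congr fun k => (hzdiag k).symm
  · have hy' : WeakLim atTop y (diagEmb n ζ) := weakLim_pi_iff.2 fun i => by
      simp_rw [hy]
      exact haw
    refine ⟨weaklyTendsto_iff_weakLim.2 ?_, weaklyTendsto_iff_weakLim.2 hy'⟩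
    have h1 := (WeakLim.of_tendsto hres).add hy'
    rw [zero_add] at h1
    simpa only [← hzdiag] using h1
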